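/- Let $A=(a_{ij})_{1\le i,j\le n}$ be the Cartan matrix of a finite-dimensional simple Lie algebra $\mathfrak g$, $d_1,\dots,d_n$ the relatively prime positive integers with $d_ia_{ij}=d_ja_{ji}$, $Q=\bigoplus_i\mathbb Z\alpha_i$ the root lattice, and $\langle\cdot,\cdot\rangle$ the bilinear Euler form on $Q$ with $\langle i,j\rangle=\langle\alpha_i,\alpha_j\rangle=d_ia_{ij}$ if $i<j$, $d_i$ if $i=j$, and $0$ if $i>j$. Let $K$ be a field of characteristic $0$ and let $r,s\in K^\times$ be such that $rs^{-1}$ is not a root of unity (for instance $K\supseteq\mathbb Q(r,s)$). Put $r_i=r^{d_i}$, $s_i=s^{d_i}$, $(m)_v=1+v+\dots+v^{m-1}$, $(m)_v!=(1)_v\cdots(m)_v$, $\binom mk_v=\frac{(m)_v!}{(k)_v!(m-k)_v!}$. The two-parameter quantum group $U_{r,s}=U_{r,s}(\mathfrak g)$ is the unital associative $K$-algebra with generators $e_i,f_i,\omega_i^{\pm1},\omega_i'^{\pm1}$ and relations: the $\omega_i^{\pm1},\omega_j'^{\pm1}$ commute and $\omega_i\omega_i^{-1}=\omega_i^{-1}\omega_i=1=\omega_i'\omega_i'^{-1}=\omega_i'^{-1}\omega_i'$;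 $$\omega_ie_j=r^{\langle j,i\rangle}s^{-\langle i,j\rangle}e_j\omega_i,\quad \omega_i'e_j=r^{-\langle i,j\rangle}s^{\langle j,i\rangle}e_j\omega_i',\quad \omega_if_j=r^{-\langle j,i\rangle}s^{\langle i,j\rangle}f_j\omega_i,\quad \omega_i'f_j=r^{\langle i,j\rangle}s^{-\langle j,i\rangle}f_j\omega_i';$$ $$e_if_j-f_je_i=\delta_{ij}\frac{\omega_i-\omega_i'}{r_i-s_i};$$ and, for $i\ne j$, with $c^{(k)}_{ij}=(r_is_i^{-1})^{k(k-1)/2}r^{k\langle j,i\rangle}s^{-k\langle i,j\rangle}$, $$\sum_{k=0}^{1-a_{ij}}(-1)^k\binom{1-a_{ij}}{k}_{r_is_i^{-1}}c^{(k)}_{ij}\,e_i^{1-a_{ij}-k}e_je_i^k=0,\qquad \sum_{k=0}^{1-a_{ij}}(-1)^k\binom{1-a_{ij}}{k}_{r_is_i^{-1}}c^{(k)}_{ij}\,f_i^kf_jf_i^{1-a_{ij}-k}=0.$$ Let $U_{r,s}^+$ (resp. $U_{r,s}^-$) be the subalgebra generated by the $e_i$ (resp. the $f_i$). For $\gamma\in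 Q$ let $(U_{r,s}^\pm)_\gamma$ be the set of $x\in U_{r,s}^\pm$ with $\omega_\mu x\omega_{-\mu}=r^{\langle\gamma,\mu\rangle}s^{-\langle\mu,\gamma\rangle}x$ and $\omega'_\mu x\omega'_{-\mu}=r^{-\langle\mu,\gamma\rangle}s^{\langle\gamma,\mu\rangle}x$ for all $\mu=\sum_i\mu_i\alpha_i\in Q$, where $\omega_\mu=\prod_i\omega_i^{\mu_i}$ and $\omega'_\mu=\prod_i\omega_i'^{\mu_i}$. The algebra $U_{r,s}$ is $Q\times Q$-graded ($Q$-bigraded) with $e_i$ of bidegree $(\alpha_i,0)$, $f_i$ of bidegree $(0,-\alpha_i)$, and $\omega_i,\omega_i'$ of bidegree $(\alpha_i,-\alpha_i)$. Let $q\in K$ satisfy $r_is_i^{-1}=q^{2d_i}$ for all $i$, and put $U_q=U_{q,q^{-1}}$, with generators $E_i,F_i,K_i^{\pm1},K_i'^{\pm1}$ in place of $e_i,f_i,\omega_i^{\pm1},\omega_i'^{\pm1}$. Let $\zeta:Q\times Q\to K^\times$ be a bicharacter that is skew, $\zeta(\mu,\nu)\zeta(\nu,\mu)=1$, with $\zeta(\alpha_i,\alpha_j)^2=p_{ij}:=r^{\langle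 j,i\rangle}s^{-\langle i,j\rangle}q^{-d_ia_{ij}}$ for all $i,j$. Let $U_{q,\zeta}$ be the $Q$-bigraded algebra with underlying bigraded vector space $U_q$ and product $x\circ y=\zeta(\gamma,\gamma')\zeta(\delta,\delta')^{-1}xy$ for $x,y$ of bidegrees $(\gamma,\delta)$, $(\gamma',\delta')$. Let $U_{q,\zeta}^\pm$ be the $Q$-graded algebra with underlying space $U_q^\pm$, graded by $\deg E_i=\alpha_i$ (resp. $\deg F_i=-\alpha_i$), and the restricted product: $x\circ y=\zeta(\beta,\beta')xy$ on $U_q^+$ and $x\circ y=\zeta(\beta,\beta')^{-1}xy$ on $U_q^-$, for $x,y$ homogeneous of degrees $\beta,\beta'$. Then there is an isomorphism of $Q$-bigraded algebras $\Phi:U_{r,s}\to U_{q,\zeta}$ with $\Phi(e_i)=E_i$, $\Phi(f_i)=(s_iq^{d_i})^{-1}F_i$, $\Phi(\omega_i)=K_i$, $\Phi(\omega_i')=K_i'$ for all $i$, and it restricts to isomorphisms of $Q$-graded algebras $$U_{r,s}^+\simeq U_{q,\zeta}^+,\qquad U_{r,s}^-\simeq U_{q,\zeta}^-,$$ where $U_{r,s}^\pm$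 is graded by the subspaces $(U_{r,s}^\pm)_\gamma$, $\gamma\in Q$. -/

import Mathlib

noncomputable section

namespace TwoParam

open scoped DirectSum

/-! ### Bicharacters and the twist of a graded algebra -/

/-- A bicharacter `ψ : G × G → Kˣ` on an (additive) abelian group `G`. -/
structure Bicharacter (G K : Type*) [AddCommGroup G] [Field K] where
  toFun : G → G → Kˣ
  add_left : ∀ a b c, toFun (a + b) c = toFun a c * toFun b c
  add_right : ∀ a b c, toFun a (b + c) = toFun a b * toFun a c

namespace Bicharacter

variable {G K : Type*} [AddCommGroup G] [Field K]

instance : CoeFun (Bicharacter G K) (fun _ => G → G → Kˣ) := ⟨toFun⟩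

/-- A bicharacter `ψ` is skew if `ψ(a, b) ψ(b, a) = 1` for all `a, b`. -/
def IsSkew (ψ : Bicharacter G K) : Prop := ∀ a b, ψ a b * ψ b a = 1

/-- The pointwise inverse `ψ⁻¹` of a bicharacter. -/
def inv (ψ : Bicharacter G K) : Bicharacter G K where
  toFun a b := (ψ a b)⁻¹
  add_left a b c := by rw [ψ.add_left, mul_inv]
  add_right a b c := by rw [ψ.add_right, mul_inv]

/-- The bicharacter `ψ~((a, b), (a', b')) = ψ(a, a') ψ(b, b')⁻¹` on `G × G`. -/
def double (ψ : Bicharacter G K) : Bicharacter (G × G) K where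
  toFun a b := ψ a.1 b.1 * (ψ a.2 b.2)⁻¹
  add_left a b c := by
    simp only [Prod.fst_add, Prod.snd_add, ψ.add_left, mul_inv]
    exact mul_mul_mul_comm _ _ _ _
  add_right a b c := by
    simp only [Prod.fst_add, Prod.snd_add, ψ.add_right, mul_inv]
    exact mul_mul_mul_comm _ _ _ _

theorem zero_left (ψ : Bicharacter G K) (a : G) : ψ 0 a = 1 := by
  have h := ψ.add_left 0 0 a
  rw [add_zero] at h
  exact left_eq_mul.mp h

theorem zero_right (ψ : Bicharacter G K) (a : G) : ψ a 0 = 1 := by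
  have h := ψ.add_right a 0 0
  rw [add_zero] at h
  exact left_eq_mul.mp h

end Bicharacter

section Twist

variable {K A G : Type*} [Field K] [Ring A] [Algebra K A] [AddCommGroup G] [DecidableEq G]
variable (𝒜 : G → Submodule K A) [GradedAlgebra 𝒜] (ψ : Bicharacter G K)

/-- The twisted product on a graded algebra, as a bilinear map: it is the bilinear map with
`x ∘ y = ψ(g, h) x y` for `x ∈ 𝒜 g` and `y ∈ 𝒜 h` (see `twistMul_of_mem`). -/
def twistMul : A →ₗ[K] A →ₗ[K] A :=
  (DirectSum.toModule K G (A →ₗ[K] A) fun g =>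
    (LinearMap.lcomp K A (DirectSum.decomposeLinearEquiv 𝒜).toLinearMap) ∘ₗ
      LinearMap.flip (DirectSum.toModule K G (𝒜 g →ₗ[K] A) fun h =>
        ((ψ g h : Kˣ) : K) •
          LinearMap.flip ((LinearMap.mul K A).compl₁₂ (𝒜 g).subtype (𝒜 h).subtype))) ∘ₗ
    (DirectSum.decomposeLinearEquiv 𝒜).toLinearMap

theorem twistMul_of_mem {g h : G} {x y : A} (hx : x ∈ 𝒜 g) (hy : y ∈ 𝒜 h) :
    twistMul 𝒜 ψ x y = ((ψ g h : Kˣ) : K) • (x * y) := by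
  simp [twistMul, DirectSum.decomposeLinearEquiv_apply, DirectSum.decompose_of_mem 𝒜 hx,
    DirectSum.decompose_of_mem 𝒜 hy, ← DirectSum.lof_eq_of K]

theorem twistMul_assoc (x y z : A) :
    twistMul 𝒜 ψ (twistMul 𝒜 ψ x y) z = twistMul 𝒜 ψ x (twistMul 𝒜 ψ y z) := by
  induction x using DirectSum.Decomposition.inductionOn 𝒜 with
  | zero => simp
  | add a b ha hb => simp only [map_add, LinearMap.add_apply, ha, hb]
  | @homogeneous i x =>
    induction y using DirectSum.Decomposition.inductionOn 𝒜 with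
    | zero => simp
    | add a b ha hb => simp only [map_add, LinearMap.add_apply, ha, hb]
    | @homogeneous j y =>
      induction z using DirectSum.Decomposition.inductionOn 𝒜 with
      | zero => simp
      | add a b ha hb => simp only [map_add, ha, hb]
      | @homogeneous k z =>
        rw [twistMul_of_mem 𝒜 ψ x.2 y.2, twistMul_of_mem 𝒜 ψ y.2 z.2, map_smul, map_smul,
          LinearMap.smul_apply,
          twistMul_of_mem 𝒜 ψ (SetLike.mul_mem_graded x.2 y.2) z.2,
          twistMul_of_mem 𝒜 ψ x.2 (SetLike.mul_mem_graded y.2 z.2), smul_smul, smul_smul,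
          mul_assoc, ψ.add_left, ψ.add_right]
        congr 1
        push_cast
        ring

theorem one_twistMul (x : A) : twistMul 𝒜 ψ 1 x = x := by
  induction x using DirectSum.Decomposition.inductionOn 𝒜 with
  | zero => simp
  | add a b ha hb => simp only [map_add, ha, hb]
  | homogeneous x => simp [twistMul_of_mem 𝒜 ψ SetLike.GradedOne.one_mem x.2, ψ.zero_left]

theorem twistMul_one (x : A) : twistMul 𝒜 ψ x 1 = x := by
  induction x using DirectSum.Decomposition.inductionOn 𝒜 with
  | zero => simp
  | add a b ha hb => simp only [map_add, LinearMap.add_apply, ha, hb]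
  | homogeneous x => simp [twistMul_of_mem 𝒜 ψ x.2 SetLike.GradedOne.one_mem, ψ.zero_right]

/-- The twist `A^ψ` of the `G`-graded algebra `A = ⨁ 𝒜 g` by the bicharacter `ψ`: the vector
space `A` with the product `x ∘ y = ψ(g, h) x y` for `x ∈ 𝒜 g`, `y ∈ 𝒜 h`. -/
@[nolint unusedArguments]
def GradedTwist (𝒜 : G → Submodule K A) [GradedAlgebra 𝒜] (_ψ : Bicharacter G K) : Type _ := A

namespace GradedTwist

instance : AddCommGroup (GradedTwist 𝒜 ψ) := inferInstanceAs (AddCommGroup A)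

instance : Module K (GradedTwist 𝒜 ψ) := inferInstanceAs (Module K A)

/-- The identity map from the underlying vector space of `A` to that of its twist `A^ψ`. -/
def of : A ≃ₗ[K] GradedTwist 𝒜 ψ := LinearEquiv.refl K A

instance : Mul (GradedTwist 𝒜 ψ) :=
  ⟨fun x y => of 𝒜 ψ (twistMul 𝒜 ψ ((of 𝒜 ψ).symm x) ((of 𝒜 ψ).symm y))⟩

instance : One (GradedTwist 𝒜 ψ) := ⟨of 𝒜 ψ 1⟩

theorem mul_def (x y : GradedTwist 𝒜 ψ) :
    x * y = of 𝒜 ψ (twistMul 𝒜 ψ ((of 𝒜 ψ).symm x) ((of 𝒜 ψ).symm y)) := rfl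

theorem one_def : (1 : GradedTwist 𝒜 ψ) = of 𝒜 ψ 1 := rfl

instance : Ring (GradedTwist 𝒜 ψ) :=
  { (inferInstance : AddCommGroup (GradedTwist 𝒜 ψ)),
    (inferInstance : Mul (GradedTwist 𝒜 ψ)),
    (inferInstance : One (GradedTwist 𝒜 ψ)) with
    left_distrib := fun x y z => by simp [mul_def]
    right_distrib := fun x y z => by simp [mul_def]
    zero_mul := fun x => by simp [mul_def]
    mul_zero := fun x => by simp [mul_def]
    mul_assoc := fun x y z => by simp [mul_def, twistMul_assoc]
    one_mul := fun x => by simp [mul_def, one_def, one_twistMul]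
    mul_one := fun x => by simp [mul_def, one_def, twistMul_one] }

instance : Algebra K (GradedTwist 𝒜 ψ) :=
  Algebra.ofModule (fun c x y => by simp [mul_def]) (fun c x y => by simp [mul_def])

/-- The homogeneous component of degree `g` of `A^ψ`; as a subspace it is `𝒜 g`. -/
def piece (g : G) : Submodule K (GradedTwist 𝒜 ψ) := (𝒜 g).map (of 𝒜 ψ).toLinearMap

theorem of_mul_of {g h : G} {x y : A} (hx : x ∈ 𝒜 g) (hy : y ∈ 𝒜 h) :
    of 𝒜 ψ x * of 𝒜 ψ y = ((ψ g h : Kˣ) : K) • of 𝒜 ψ (x * y) := by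
  simp [mul_def, twistMul_of_mem 𝒜 ψ hx hy]

end GradedTwist

end Twist

/-! ### Root datum -/

/-- The root lattice `Q = ⨁ ℤ αᵢ`, in coordinates with respect to the simple roots. -/
abbrev RootLattice (n : ℕ) := Fin n → ℤ

/-- The simple root `αᵢ`. -/
def α {n : ℕ} (i : Fin n) : RootLattice n := Pi.single i 1

/-- `A` is the Cartan matrix of a finite-dimensional (split) simple Lie algebra, i.e. an
indecomposable Cartan matrix of finite type, and the `dᵢ` are the relatively prime positive
integers with `dᵢ aᵢⱼ = dⱼ aⱼᵢ`. -/
structure IsSimpleCartan {n : ℕ} (A : Matrix (Fin n) (Fin n) ℤ) (d : Fin n → ℕ) : Prop where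
  diag : ∀ i, A i i = 2
  offDiag : ∀ i j, i ≠ j → A i j ≤ 0
  zero_iff : ∀ i j, A i j = 0 ↔ A j i = 0
  d_pos : ∀ i, 0 < d i
  d_gcd : Finset.univ.gcd d = 1
  symm : ∀ i j, (d i : ℤ) * A i j = d j * A j i
  posDef : ∀ μ : RootLattice n, μ ≠ 0 → 0 < ∑ i, ∑ j, μ i * μ j * (d i * A i j)
  indecomposable : ∀ J : Set (Fin n), J.Nonempty → Jᶜ.Nonempty → ∃ i ∈ J, ∃ j ∈ Jᶜ, A i j ≠ 0

/-- The Euler form `⟨i, j⟩ = ⟨αᵢ, αⱼ⟩` on simple roots. -/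
def euler {n : ℕ} (A : Matrix (Fin n) (Fin n) ℤ) (d : Fin n → ℕ) (i j : Fin n) : ℤ :=
  if i < j then d i * A i j else if i = j then d i else 0

/-- The Euler form `⟨μ, ν⟩` on the root lattice. -/
def eulerForm {n : ℕ} (A : Matrix (Fin n) (Fin n) ℤ) (d : Fin n → ℕ) (μ ν : RootLattice n) : ℤ :=
  ∑ i, ∑ j, μ i * ν j * euler A d i j

/-! ### `v`-binomial coefficients -/

/-- `(m)_v = 1 + v + ⋯ + v^(m-1)`. -/
def vNum {K : Type*} [Field K] (v : K) (m : ℕ) : K := ∑ k ∈ Finset.range m, v ^ k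

/-- `(m)_v! = (1)_v (2)_v ⋯ (m)_v`. -/
def vFact {K : Type*} [Field K] (v : K) (m : ℕ) : K := ∏ k ∈ Finset.range m, vNum v (k + 1)

/-- The `v`-binomial coefficient `(m)_v! / ((k)_v! (m-k)_v!)`, for `k ≤ m`. -/
def vBinom {K : Type*} [Field K] (v : K) (m k : ℕ) : K :=
  vFact v m / (vFact v k * vFact v (m - k))

/-! ### The two-parameter quantum group -/

/-- The generators `eᵢ`, `fᵢ`, `ωᵢ`, `ωᵢ⁻¹`, `ωᵢ'`, `ωᵢ'⁻¹` (in this order). -/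
inductive Gen (n : ℕ) : Type
  | e (i : Fin n)
  | f (i : Fin n)
  | om (i : Fin n)
  | omInv (i : Fin n)
  | omp (i : Fin n)
  | ompInv (i : Fin n)

section QuantumGroup

variable {K : Type*} [Field K] {n : ℕ}

open FreeAlgebra (ι)

/-- The scalar `c_{ij}^{(k)}` of the Serre relations. -/
def serreC (A : Matrix (Fin n) (Fin n) ℤ) (d : Fin n → ℕ) (r s : K) (i j : Fin n) (k : ℕ) : K :=
  (r ^ d i / s ^ d i) ^ (k * (k - 1) / 2) *
    (r ^ ((k : ℤ) * euler A d j i) * s ^ (-((k : ℤ) * euler A d i j)))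

/-- The coefficient of the `k`-th term of the Serre relations for the pair `(i, j)`. -/
def serreCoeff (A : Matrix (Fin n) (Fin n) ℤ) (d : Fin n → ℕ) (r s : K) (i j : Fin n) (k : ℕ) :
    K :=
  (-1) ^ k * vBinom (r ^ d i / s ^ d i) (1 - A i j).toNat k * serreC A d r s i j k

/-- The defining relations of `U_{r,s}`. -/
inductive Rel (A : Matrix (Fin n) (Fin n) ℤ) (d : Fin n → ℕ) (r s : K) :
    FreeAlgebra K (Gen n) → FreeAlgebra K (Gen n) → Prop
  | om_omInv (i) : Rel A d r s (ι K (.om i) * ι K (.omInv i)) 1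
  | omInv_om (i) : Rel A d r s (ι K (.omInv i) * ι K (.om i)) 1
  | omp_ompInv (i) : Rel A d r s (ι K (.omp i) * ι K (.ompInv i)) 1
  | ompInv_omp (i) : Rel A d r s (ι K (.ompInv i) * ι K (.omp i)) 1
  | om_om (i j) : Rel A d r s (ι K (.om i) * ι K (.om j)) (ι K (.om j) * ι K (.om i))
  | omp_omp (i j) : Rel A d r s (ι K (.omp i) * ι K (.omp j)) (ι K (.omp j) * ι K (.omp i))
  | om_omp (i j) : Rel A d r s (ι K (.om i) * ι K (.omp j)) (ι K (.omp j) * ι K (.om i))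
  | om_e (i j) : Rel A d r s (ι K (.om i) * ι K (.e j))
      ((r ^ euler A d j i * s ^ (-euler A d i j)) • (ι K (.e j) * ι K (.om i)))
  | omp_e (i j) : Rel A d r s (ι K (.omp i) * ι K (.e j))
      ((r ^ (-euler A d i j) * s ^ euler A d j i) • (ι K (.e j) * ι K (.omp i)))
  | om_f (i j) : Rel A d r s (ι K (.om i) * ι K (.f j))
      ((r ^ (-euler A d j i) * s ^ euler A d i j) • (ι K (.f j) * ι K (.om i)))
  | omp_f (i j) : Rel A d r s (ι K (.omp i) * ι K (.f j))
      ((r ^ euler A d i j * s ^ (-euler A d j i)) • (ι K (.f j) * ι K (.omp i)))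
  | e_f_same (i) : Rel A d r s (ι K (.e i) * ι K (.f i) - ι K (.f i) * ι K (.e i))
      ((r ^ d i - s ^ d i)⁻¹ • (ι K (.om i) - ι K (.omp i)))
  | e_f_ne (i j) (hij : i ≠ j) :
      Rel A d r s (ι K (.e i) * ι K (.f j) - ι K (.f j) * ι K (.e i)) 0
  | serre_e (i j) (hij : i ≠ j) : Rel A d r s
      (∑ k ∈ Finset.range ((1 - A i j).toNat + 1), serreCoeff A d r s i j k •
        (ι K (.e i) ^ ((1 - A i j).toNat - k) * ι K (.e j) * ι K (.e i) ^ k)) 0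
  | serre_f (i j) (hij : i ≠ j) : Rel A d r s
      (∑ k ∈ Finset.range ((1 - A i j).toNat + 1), serreCoeff A d r s i j k •
        (ι K (.f i) ^ k * ι K (.f j) * ι K (.f i) ^ ((1 - A i j).toNat - k))) 0

variable (A : Matrix (Fin n) (Fin n) ℤ) (d : Fin n → ℕ) (r s : K)

/-- The two-parameter quantum group `U_{r,s}` attached to `A` and `d`. The one-parameter quantum
group `U_q` (with doubled group-like elements) is `U A d q q⁻¹`. -/
def U : Type _ := RingQuot (Rel A d r s)

instance : Ring (U A d r s) := inferInstanceAs (Ring (RingQuot (Rel A d r s)))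

instance : Algebra K (U A d r s) := inferInstanceAs (Algebra K (RingQuot (Rel A d r s)))

/-- The quotient map from the free algebra onto `U_{r,s}`. -/
def mk : FreeAlgebra K (Gen n) →ₐ[K] U A d r s := RingQuot.mkAlgHom K (Rel A d r s)

/-- The generators as elements of `U_{r,s}`. -/
def gen (x : Gen n) : U A d r s := mk A d r s (ι K x)

theorem mk_rel {x y : FreeAlgebra K (Gen n)} (h : Rel A d r s x y) :
    mk A d r s x = mk A d r s y := RingQuot.mkAlgHom_rel K h

/-- `ωᵢ` as a unit of `U_{r,s}`. -/
def omUnit (i : Fin n) : (U A d r s)ˣ where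
  val := gen A d r s (.om i)
  inv := gen A d r s (.omInv i)
  val_inv := by simpa [gen] using mk_rel A d r s (.om_omInv i)
  inv_val := by simpa [gen] using mk_rel A d r s (.omInv_om i)

/-- `ωᵢ'` as a unit of `U_{r,s}`. -/
def ompUnit (i : Fin n) : (U A d r s)ˣ where
  val := gen A d r s (.omp i)
  inv := gen A d r s (.ompInv i)
  val_inv := by simpa [gen] using mk_rel A d r s (.omp_ompInv i)
  inv_val := by simpa [gen] using mk_rel A d r s (.ompInv_omp i)

/-- `ω_μ = ∏ ωᵢ ^ μᵢ`. -/
def omMu (μ : RootLattice n) : U A d r s :=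
  ((List.ofFn fun i => omUnit A d r s i ^ μ i).prod : (U A d r s)ˣ)

/-- `ω'_μ = ∏ ωᵢ' ^ μᵢ`. -/
def ompMu (μ : RootLattice n) : U A d r s :=
  ((List.ofFn fun i => ompUnit A d r s i ^ μ i).prod : (U A d r s)ˣ)

/-- `U⁺`, the subalgebra generated by the `eᵢ`. -/
def plus : Subalgebra K (U A d r s) := Algebra.adjoin K (Set.range fun i => gen A d r s (.e i))

/-- `U⁻`, the subalgebra generated by the `fᵢ`. -/
def minus : Subalgebra K (U A d r s) := Algebra.adjoin K (Set.range fun i => gen A d r s (.f i))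

/-- The weight space of weight `γ ∈ Q` in a subalgebra `S` of `U_{r,s}`:
the `x ∈ S` with `ω_μ x ω_{-μ} = r^⟨γ,μ⟩ s^{-⟨μ,γ⟩} x` and
`ω'_μ x ω'_{-μ} = r^{-⟨μ,γ⟩} s^⟨γ,μ⟩ x` for all `μ ∈ Q`. -/
def weightSpace (S : Subalgebra K (U A d r s)) (γ : RootLattice n) : Submodule K S where
  carrier := {x | ∀ μ : RootLattice n,
    omMu A d r s μ * (x : U A d r s) * omMu A d r s (-μ) =
        (r ^ eulerForm A d γ μ * s ^ (-eulerForm A d μ γ)) • (x : U A d r s) ∧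
    ompMu A d r s μ * (x : U A d r s) * ompMu A d r s (-μ) =
        (r ^ (-eulerForm A d μ γ) * s ^ eulerForm A d γ μ) • (x : U A d r s)}
  zero_mem' := fun μ => by simp
  add_mem' := fun {x y} hx hy μ => by
    simp only [Subalgebra.coe_add, mul_add, add_mul, smul_add]
    exact ⟨by rw [(hx μ).1, (hy μ).1], by rw [(hx μ).2, (hy μ).2]⟩
  smul_mem' := fun c x hx μ => by
    simp only [Subalgebra.coe_smul, mul_smul_comm, smul_mul_assoc]
    exact ⟨by rw [(hx μ).1, smul_comm], by rw [(hx μ).2, smul_comm]⟩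

/-! ### The bigrading -/

/-- The bidegrees of the generators: `eᵢ` has bidegree `(αᵢ, 0)`, `fᵢ` has bidegree `(0, -αᵢ)`,
`ωᵢ` and `ωᵢ'` have bidegree `(αᵢ, -αᵢ)`, and their inverses the opposite one. -/
def bideg : Gen n → RootLattice n × RootLattice n
  | .e i => (α i, 0)
  | .f i => (0, -α i)
  | .om i => (α i, -α i)
  | .omInv i => (-α i, α i)
  | .omp i => (α i, -α i)
  | .ompInv i => (-α i, α i)

end QuantumGroup

section WordSpan

variable (K : Type*) [Field K] {B X G : Type*} [Ring B] [Algebra K B] [AddCommGroup G]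

/-- The span of the monomials of degree `γ` in elements `g x` of degree `deg x`. -/
def wordSpan (g : X → B) (deg : X → G) (γ : G) : Submodule K B :=
  Submodule.span K {b | ∃ w : List X, (w.map deg).sum = γ ∧ (w.map g).prod = b}

variable {K} {g : X → B} {deg : X → G}

theorem wordSpan_one : (1 : B) ∈ wordSpan K g deg 0 :=
  Submodule.subset_span ⟨[], by simp, by simp⟩

theorem wordSpan_gen (x : X) : g x ∈ wordSpan K g deg (deg x) :=
  Submodule.subset_span ⟨[x], by simp, by simp⟩

theorem wordSpan_mul {γ δ : G} {a b : B} (ha : a ∈ wordSpan K g deg γ)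
    (hb : b ∈ wordSpan K g deg δ) : a * b ∈ wordSpan K g deg (γ + δ) := by
  induction ha using Submodule.span_induction with
  | zero => simp
  | add x y _ _ hx hy => rw [add_mul]; exact add_mem hx hy
  | smul c x _ hx => rw [smul_mul_assoc]; exact Submodule.smul_mem _ _ hx
  | mem x hx =>
    obtain ⟨w, rfl, rfl⟩ := hx
    induction hb using Submodule.span_induction with
    | zero => simp
    | add x y _ _ hx hy => rw [mul_add]; exact add_mem hx hy
    | smul c x _ hx => rw [mul_smul_comm]; exact Submodule.smul_mem _ _ hx
    | mem y hy =>
      obtain ⟨w', rfl, rfl⟩ := hy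
      exact Submodule.subset_span ⟨w ++ w', by simp, by simp⟩

theorem wordSpan_pow {γ : G} {a : B} (ha : a ∈ wordSpan K g deg γ) (m : ℕ) :
    a ^ m ∈ wordSpan K g deg (m • γ) := by
  induction m with
  | zero => simpa using wordSpan_one
  | succ m ih => rw [pow_succ, succ_nsmul]; exact wordSpan_mul ih ha

instance wordSpan_graded : SetLike.GradedMonoid (wordSpan K g deg) where
  one_mem := wordSpan_one
  mul_mem _ _ _ _ := wordSpan_mul

end WordSpan

section Grading

variable {K : Type*} [Field K] {n : ℕ}
variable (A : Matrix (Fin n) (Fin n) ℤ) (d : Fin n → ℕ) (r s : K)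

/-- The component of `U_{r,s}` of bidegree `γ ∈ Q × Q`: the span of the monomials of bidegree `γ`
in the generators. -/
def bigrading (γ : RootLattice n × RootLattice n) : Submodule K (U A d r s) :=
  wordSpan K (gen A d r s) bideg γ

instance : SetLike.GradedMonoid (bigrading A d r s) := wordSpan_graded

theorem rel_homogeneous {x y : FreeAlgebra K (Gen n)} (h : Rel A d r s x y) :
    ∃ γ, x ∈ wordSpan K (FreeAlgebra.ι K) bideg γ ∧ y ∈ wordSpan K (FreeAlgebra.ι K) bideg γ := by
  have g (x : Gen n) := wordSpan_gen (K := K) (g := FreeAlgebra.ι K) (deg := bideg) x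
  have m (x y : Gen n) := wordSpan_mul (g x) (g y)
  have m' (x y : Gen n) := add_comm (bideg x) (bideg y) ▸ m y x
  have one {γ : RootLattice n × RootLattice n} (h : γ = 0) :
      (1 : FreeAlgebra K (Gen n)) ∈ wordSpan K (FreeAlgebra.ι K) bideg γ := h ▸ wordSpan_one
  cases h with
  | om_omInv i => exact ⟨_, m (.om i) (.omInv i), one (by ext <;> simp [bideg])⟩
  | omInv_om i => exact ⟨_, m (.omInv i) (.om i), one (by ext <;> simp [bideg])⟩
  | omp_ompInv i => exact ⟨_, m (.omp i) (.ompInv i), one (by ext <;> simp [bideg])⟩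
  | ompInv_omp i => exact ⟨_, m (.ompInv i) (.omp i), one (by ext <;> simp [bideg])⟩
  | om_om i j => exact ⟨_, m _ _, m' _ _⟩
  | omp_omp i j => exact ⟨_, m _ _, m' _ _⟩
  | om_omp i j => exact ⟨_, m _ _, m' _ _⟩
  | om_e i j => exact ⟨_, m _ _, Submodule.smul_mem _ _ (m' _ _)⟩
  | omp_e i j => exact ⟨_, m _ _, Submodule.smul_mem _ _ (m' _ _)⟩
  | om_f i j => exact ⟨_, m _ _, Submodule.smul_mem _ _ (m' _ _)⟩
  | omp_f i j => exact ⟨_, m _ _, Submodule.smul_mem _ _ (m' _ _)⟩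
  | e_f_same i =>
    refine ⟨(α i, -α i), sub_mem ?_ ?_, Submodule.smul_mem _ _ (sub_mem (g (.om i)) (g (.omp i)))⟩
    · simpa [bideg] using m (.e i) (.f i)
    · simpa [bideg] using m (.f i) (.e i)
  | e_f_ne i j _ => exact ⟨_, sub_mem (m _ _) (m' _ _), zero_mem _⟩
  | serre_e i j _ =>
    refine ⟨(1 - A i j).toNat • bideg (.e i) + bideg (.e j), sum_mem fun k hk => ?_, zero_mem _⟩
    refine Submodule.smul_mem _ _ ?_
    have := wordSpan_mul (wordSpan_mul (wordSpan_pow (g (.e i)) ((1 - A i j).toNat - k))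
      (g (.e j))) (wordSpan_pow (g (.e i)) k)
    rwa [add_right_comm, ← add_smul, Nat.sub_add_cancel (by simpa [Nat.lt_succ_iff] using hk)]
      at this
  | serre_f i j _ =>
    refine ⟨(1 - A i j).toNat • bideg (.f i) + bideg (.f j), sum_mem fun k hk => ?_, zero_mem _⟩
    refine Submodule.smul_mem _ _ ?_
    have := wordSpan_mul (wordSpan_mul (wordSpan_pow (g (.f i)) k)
      (g (.f j))) (wordSpan_pow (g (.f i)) ((1 - A i j).toNat - k))
    rwa [add_right_comm, ← add_smul, Nat.add_sub_cancel' (by simpa [Nat.lt_succ_iff] using hk)]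
      at this

/-- Auxiliary: the map from the free algebra to the direct sum of the components. -/
def freeDecompose : FreeAlgebra K (Gen n) →ₐ[K] ⨁ γ, bigrading A d r s γ :=
  FreeAlgebra.lift K fun x =>
    DirectSum.of (fun γ => bigrading A d r s γ) (bideg x) ⟨gen A d r s x, wordSpan_gen x⟩

theorem freeDecompose_word (w : List (Gen n)) :
    ∃ y : bigrading A d r s (w.map bideg).sum,
      (y : U A d r s) = (w.map (gen A d r s)).prod ∧
      freeDecompose A d r s (w.map (FreeAlgebra.ι K)).prod =
        DirectSum.of (fun γ => bigrading A d r s γ) (w.map bideg).sum y := by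
  induction w with
  | nil => exact ⟨⟨1, wordSpan_one⟩, by simp, by simp; rfl⟩
  | cons a w ih =>
    obtain ⟨y, hy, h⟩ := ih
    refine ⟨⟨gen A d r s a * y, ?_⟩, ?_, ?_⟩
    · rw [List.map_cons, List.sum_cons]
      exact wordSpan_mul (wordSpan_gen a) y.2
    · simp [hy]
    · simp only [List.map_cons, List.prod_cons, map_mul, h]
      simp only [freeDecompose, FreeAlgebra.lift_ι_apply, DirectSum.of_mul_of]
      rfl

theorem freeDecompose_of_mem {γ : RootLattice n × RootLattice n} {x : FreeAlgebra K (Gen n)}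
    (hx : x ∈ wordSpan K (FreeAlgebra.ι K) bideg γ) :
    ∃ y : bigrading A d r s γ, (y : U A d r s) = mk A d r s x ∧
      freeDecompose A d r s x = DirectSum.of (fun γ => bigrading A d r s γ) γ y := by
  induction hx using Submodule.span_induction with
  | zero => exact ⟨0, by simp, by simp⟩
  | add a b _ _ ha hb =>
    obtain ⟨y, hy, h⟩ := ha
    obtain ⟨z, hz, h'⟩ := hb
    exact ⟨y + z, by simp [hy, hz], by simp [h, h']⟩
  | smul c a _ ha =>
    obtain ⟨y, hy, h⟩ := ha
    refine ⟨c • y, by simp [hy], ?_⟩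
    rw [map_smul, h, ← DirectSum.lof_eq_of K, ← DirectSum.lof_eq_of K, map_smul]
  | mem a ha =>
    obtain ⟨w, rfl, rfl⟩ := ha
    obtain ⟨y, hy, h⟩ := freeDecompose_word A d r s w
    refine ⟨y, ?_, h⟩
    rw [hy, map_list_prod, List.map_map]
    rfl

/-- Auxiliary: the decomposition map of `U_{r,s}` into its components. -/
def decomposeHom : U A d r s →ₐ[K] ⨁ γ, bigrading A d r s γ :=
  RingQuot.liftAlgHom K ⟨freeDecompose A d r s, fun x y h => by
    obtain ⟨γ, hx, hy⟩ := rel_homogeneous A d r s h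
    obtain ⟨x', hx', ex⟩ := freeDecompose_of_mem A d r s hx
    obtain ⟨y', hy', ey⟩ := freeDecompose_of_mem A d r s hy
    have : x' = y' := Subtype.ext (by rw [hx', hy', mk_rel A d r s h])
    rw [ex, ey, this]⟩

theorem decomposeHom_mk (x : FreeAlgebra K (Gen n)) :
    decomposeHom A d r s (mk A d r s x) = freeDecompose A d r s x :=
  RingQuot.liftAlgHom_mkAlgHom_apply K _ _ _

/-- `U_{r,s}` is a `Q × Q`-graded algebra. -/
instance : GradedAlgebra (bigrading A d r s) :=
  GradedAlgebra.ofAlgHom (bigrading A d r s) (decomposeHom A d r s)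
    (by
      refine RingQuot.ringQuot_ext' K _ _ (FreeAlgebra.hom_ext ?_)
      funext x
      have h : DirectSum.coeAlgHom (bigrading A d r s)
          (decomposeHom A d r s (mk A d r s (FreeAlgebra.ι K x))) =
          mk A d r s (FreeAlgebra.ι K x) := by
        rw [decomposeHom_mk, freeDecompose, FreeAlgebra.lift_ι_apply, DirectSum.coeAlgHom_of]
        rfl
      exact h)
    (by
      rintro γ ⟨x, hx⟩
      dsimp only
      induction hx using Submodule.span_induction with
      | zero => rw [map_zero]; exact (map_zero _).symm
      | add a b ha hb iha ihb => rw [map_add, iha, ihb, ← map_add]; rfl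
      | smul c a ha iha =>
        rw [map_smul, iha, ← DirectSum.lof_eq_of K, ← DirectSum.lof_eq_of K, ← map_smul]; rfl
      | mem a ha =>
        obtain ⟨w, rfl, rfl⟩ := ha
        obtain ⟨y, hy, h⟩ := freeDecompose_word A d r s w
        have e : (w.map (gen A d r s)).prod = mk A d r s (w.map (FreeAlgebra.ι K)).prod := by
          rw [map_list_prod, List.map_map]; rfl
        have hy' : y = ⟨(w.map (gen A d r s)).prod, Submodule.subset_span ⟨w, rfl, rfl⟩⟩ :=
          Subtype.ext hy
        rw [← hy', e, decomposeHom_mk, h])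

end Grading

/-! ### The `Q`-gradings of `U⁺` and `U⁻` -/

section SubGrading

variable {K B G H : Type*} [Field K] [Ring B] [Algebra K B] [AddCommGroup G] [DecidableEq G]
  [AddCommGroup H] [DecidableEq H]

/-- For a subalgebra `S` of a `G`-graded algebra and a homomorphism `j : H → G`, the `H`-indexed
family of subspaces `S ∩ 𝒜 (j h)` of `S`. -/
def subGrading (𝒜 : G → Submodule K B) (S : Subalgebra K B) (j : H →+ G) (h : H) :
    Submodule K S := (𝒜 (j h)).comap S.val.toLinearMap

/-- If `j` is injective and `S` is generated by homogeneous elements with degrees in the image of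
`j`, then `subGrading` is a grading of `S`. -/
@[reducible]
def subGradedAlgebra (𝒜 : G → Submodule K B) [GradedAlgebra 𝒜] (j : H →+ G)
    (hj : Function.Injective j) {X : Type*} (g : X → B) (deg : X → H)
    (hg : ∀ x, g x ∈ 𝒜 (j (deg x))) :
    GradedAlgebra (subGrading 𝒜 (Algebra.adjoin K (Set.range g)) j) :=
  have gm : SetLike.GradedMonoid (subGrading 𝒜 (Algebra.adjoin K (Set.range g)) j) :=
    { one_mem := by
        change (1 : B) ∈ 𝒜 (j 0)
        rw [map_zero]; exact SetLike.GradedOne.one_mem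
      mul_mem := fun a b x y hx hy => by
        change (x : B) * (y : B) ∈ 𝒜 (j (a + b))
        rw [map_add]; exact SetLike.mul_mem_graded hx hy }
  have internal : DirectSum.IsInternal (subGrading 𝒜 (Algebra.adjoin K (Set.range g)) j) := by
    refine DirectSum.isInternal_submodule_of_iSupIndep_of_iSup_eq_top ?_ ?_
    · have h1 : iSupIndep fun h => 𝒜 (j h) :=
        (DirectSum.Decomposition.isInternal 𝒜).submodule_iSupIndep.comp hj
      rw [iSupIndep_def] at h1 ⊢
      intro i
      rw [Submodule.disjoint_def]
      intro x hx hx'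
      have := Submodule.disjoint_def.mp (h1 i) (x : B) hx
        (by
          have h2 := Submodule.mem_map_of_mem
            (f := (Algebra.adjoin K (Set.range g)).val.toLinearMap) hx'
          refine Submodule.map_le_iff_le_comap.mpr (iSup₂_le fun k hk => ?_) h2
          exact Submodule.comap_mono (le_iSup₂_of_le k hk le_rfl))
      exact Subtype.ext this
    · rw [eq_top_iff]
      rintro ⟨x, hx⟩ -
      induction hx using Algebra.adjoin_induction with
      | mem x hx =>
        obtain ⟨y, rfl⟩ := hx
        exact Submodule.mem_iSup_of_mem (deg y) (hg y)
      | algebraMap c =>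
        refine Submodule.mem_iSup_of_mem 0 ?_
        change algebraMap K B c ∈ 𝒜 (j 0)
        rw [map_zero, Algebra.algebraMap_eq_smul_one]
        exact Submodule.smul_mem _ _ SetLike.GradedOne.one_mem
      | add x y hx hy ihx ihy => exact add_mem ihx ihy
      | mul x y hx hy ihx ihy =>
        have key : ∀ a ∈ ⨆ i, subGrading 𝒜 (Algebra.adjoin K (Set.range g)) j i,
            ∀ b ∈ ⨆ i, subGrading 𝒜 (Algebra.adjoin K (Set.range g)) j i,
            a * b ∈ ⨆ i, subGrading 𝒜 (Algebra.adjoin K (Set.range g)) j i := by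
          intro a ha b hb
          induction ha using Submodule.iSup_induction' with
          | zero => simp
          | add a a' _ _ h h' => rw [add_mul]; exact add_mem h h'
          | mem i a ha =>
            induction hb using Submodule.iSup_induction' with
            | zero => simp
            | add b b' _ _ h h' => rw [mul_add]; exact add_mem h h'
            | mem k b hb => exact Submodule.mem_iSup_of_mem (i + k) (gm.mul_mem ha hb)
        exact key _ ihx _ ihy
  { gm, internal.chooseDecomposition with }

end SubGrading

section PlusMinus

variable {K : Type*} [Field K] {n : ℕ}
variable (A : Matrix (Fin n) (Fin n) ℤ) (d : Fin n → ℕ) (r s : K)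

/-- The `Q`-grading of `U⁺`: the component of degree `β` is `U⁺ ∩ U_{(β, 0)}`. -/
def plusGrading : RootLattice n → Submodule K (plus A d r s) :=
  subGrading (bigrading A d r s) (plus A d r s)
    (AddMonoidHom.inl (RootLattice n) (RootLattice n))

/-- The `Q`-grading of `U⁻`: the component of degree `β` is `U⁻ ∩ U_{(0, β)}`. -/
def minusGrading : RootLattice n → Submodule K (minus A d r s) :=
  subGrading (bigrading A d r s) (minus A d r s)
    (AddMonoidHom.inr (RootLattice n) (RootLattice n))

instance : GradedAlgebra (plusGrading A d r s) :=
  subGradedAlgebra (bigrading A d r s) _ (fun _ _ h => congrArg Prod.fst h)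
    (fun i => gen A d r s (.e i)) α (fun i => wordSpan_gen (deg := bideg) (.e i))

instance : GradedAlgebra (minusGrading A d r s) :=
  subGradedAlgebra (bigrading A d r s) _ (fun _ _ h => congrArg Prod.snd h)
    (fun i => gen A d r s (.f i)) (fun i => -α i) (fun i => wordSpan_gen (deg := bideg) (.f i))

variable (q : K) (ζ : Bicharacter (RootLattice n) K)

/-- `U_{q,ζ}`: the algebra `U_q` with the product `x ∘ y = ζ(γ, γ') ζ(δ, δ')⁻¹ x y` for
`x` of bidegree `(γ, δ)` and `y` of bidegree `(γ', δ')`. -/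
abbrev UTwist := GradedTwist (bigrading A d q q⁻¹) ζ.double

/-- `U_{q,ζ}⁺`: the algebra `U_q⁺` with the restricted product
`x ∘ y = ζ(β, β') x y` for `x` of degree `β` and `y` of degree `β'`. -/
abbrev UTwistPlus := GradedTwist (plusGrading A d q q⁻¹) ζ

/-- `U_{q,ζ}⁻`: the algebra `U_q⁻` with the restricted product
`x ∘ y = ζ(β, β')⁻¹ x y` for `x` of degree `β` and `y` of degree `β'`. -/
abbrev UTwistMinus := GradedTwist (minusGrading A d q q⁻¹) ζ.inv

/-- The inclusion of `U_{q,ζ}⁺` into `U_{q,ζ}` (the inclusion of `U_q⁺` into `U_q`). -/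
def plusIncl : UTwistPlus A d q ζ →ₗ[K] UTwist A d q ζ :=
  (GradedTwist.of (bigrading A d q q⁻¹) ζ.double).toLinearMap ∘ₗ
    (plus A d q q⁻¹).val.toLinearMap ∘ₗ
      (GradedTwist.of (plusGrading A d q q⁻¹) ζ).symm.toLinearMap

/-- The inclusion of `U_{q,ζ}⁻` into `U_{q,ζ}` (the inclusion of `U_q⁻` into `U_q`). -/
def minusIncl : UTwistMinus A d q ζ →ₗ[K] UTwist A d q ζ :=
  (GradedTwist.of (bigrading A d q q⁻¹) ζ.double).toLinearMap ∘ₗ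
    (minus A d q q⁻¹).val.toLinearMap ∘ₗ
      (GradedTwist.of (minusGrading A d q q⁻¹) ζ.inv).symm.toLinearMap

/-- The generators of `U_q`, regarded as elements of `U_{q,ζ}`. -/
def twistGen (x : Gen n) : UTwist A d q ζ :=
  GradedTwist.of (bigrading A d q q⁻¹) ζ.double (gen A d q q⁻¹ x)

/-- `p_{ij} = r^⟨j,i⟩ s^{-⟨i,j⟩} q^{-dᵢ aᵢⱼ}`. -/
def pScalar (i j : Fin n) : K :=
  r ^ euler A d j i * s ^ (-euler A d i j) * q ^ (-((d i : ℤ) * A i j))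

end PlusMinus

end TwoParam

end

open TwoParam

/-! The twist only rescales products of homogeneous elements, so each defining relation of U_{r,s}
can be checked in it by comparing scalars. Write ζ~ for the bicharacter on Q × Q. Exchanging ωᵢ and
eⱼ in the twist produces ζ~/ζ~ᵒᵖ = ζ(αᵢ, αⱼ)², by skewness, and this is exactly the discrepancy
p_{ij} between the structure constants for (r, s) and for (q, q⁻¹). In a Serre relation the k-th
term acquires a factor independent of k times ζ(αᵢ, αⱼ)^{-2k}, which cancels the change of
c^{(k)}_{ij} by p_{ij}^k. Since ζ~ is trivial between bidegrees (αᵢ, 0) and (0, -αⱼ), the commutator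
of eᵢ and fᵢ changes only in the denominator rᵢ - sᵢ, and rescaling fᵢ absorbs this. These checks
are `TwistCompat.freeTwist_rel`.

Bijectivity needs no PBW basis. The conditions collected in `TwistCompat` relate two arbitrary
parameter pairs and are symmetric under exchanging the pairs and inverting ζ. So there is a map in
each direction; both preserve bidegrees, and on words their scalars cancel letter by letter
(`TwistCompat.lin_lin_word`).

For U^±, a subalgebra generated by homogeneous elements and the one generated by the same elements
in the twist have the same underlying space (`GradedTwist.of_mem_adjoin_iff`), so the isomorphism
restricts (`TwistCompat.exists_restrict`). The grading by weight spaces agrees with the one induced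
by the bigrading (`weightSpace_eq_subGrading`): conjugation by ω_μ acts on total degree γ by a
character of μ, and distinct γ give distinct characters because ⟨μ, μ⟩ > 0 for μ ≠ 0 and r/s is not
a root of unity. -/

noncomputable section

namespace TwoParam

open scoped DirectSum

/-! ### Elementary identities for bicharacters -/

namespace Bicharacter

variable {G K : Type*} [AddCommGroup G] [Field K]

theorem neg_left (ψ : Bicharacter G K) (a b : G) : ψ (-a) b = (ψ a b)⁻¹ := by
  rw [eq_inv_iff_mul_eq_one, ← ψ.add_left, neg_add_cancel, ψ.zero_left]

theorem neg_right (ψ : Bicharacter G K) (a b : G) : ψ a (-b) = (ψ a b)⁻¹ := by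
  rw [eq_inv_iff_mul_eq_one, ← ψ.add_right, neg_add_cancel, ψ.zero_right]

theorem nsmul_left (ψ : Bicharacter G K) (m : ℕ) (a b : G) : ψ (m • a) b = ψ a b ^ m := by
  induction m with
  | zero => rw [zero_smul, ψ.zero_left, pow_zero]
  | succ m ih => rw [succ_nsmul, ψ.add_left, ih, pow_succ]

theorem nsmul_right (ψ : Bicharacter G K) (m : ℕ) (a b : G) : ψ a (m • b) = ψ a b ^ m := by
  induction m with
  | zero => rw [zero_smul, ψ.zero_right, pow_zero]
  | succ m ih => rw [succ_nsmul, ψ.add_right, ih, pow_succ]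

theorem inv_apply (ψ : Bicharacter G K) (a b : G) : ψ.inv a b = (ψ a b)⁻¹ := rfl

theorem double_apply (ψ : Bicharacter G K) (a b : G × G) :
    ψ.double a b = ψ a.1 b.1 * (ψ a.2 b.2)⁻¹ := rfl

theorem IsSkew.inv {ψ : Bicharacter G K} (h : ψ.IsSkew) : ψ.inv.IsSkew := fun a b => by
  rw [inv_apply, inv_apply, ← mul_inv, h a b, inv_one]

theorem IsSkew.swap {ψ : Bicharacter G K} (h : ψ.IsSkew) (a b : G) : ψ b a = (ψ a b)⁻¹ :=
  eq_inv_of_mul_eq_one_right (h a b)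

end Bicharacter

/-! ### Powers, words and generated subalgebras in a twist -/

namespace GradedTwist

variable {K B G : Type*} [Field K] [Ring B] [Algebra K B] [AddCommGroup G] [DecidableEq G]
variable (𝒜 : G → Submodule K B) [GradedAlgebra 𝒜] (ψ : Bicharacter G K)

theorem of_mem_piece {g : G} {x : B} : of 𝒜 ψ x ∈ piece 𝒜 ψ g ↔ x ∈ 𝒜 g := by
  simp [piece]

/-- Each of the `m.choose 2` pairs of factors contributes one ψ(g, g). -/
theorem pow_of {g : G} {x : B} (hx : x ∈ 𝒜 g) (m : ℕ) :
    of 𝒜 ψ x ^ m = ((ψ g g ^ m.choose 2 : Kˣ) : K) • of 𝒜 ψ (x ^ m) := by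
  induction m with
  | zero => simp [one_def]
  | succ m ih =>
    rw [pow_succ, ih, smul_mul_assoc, of_mul_of 𝒜 ψ (SetLike.pow_mem_graded m hx) hx,
      ψ.nsmul_left, smul_smul, ← pow_succ, ← Units.val_mul, ← pow_add, Nat.choose_succ_succ' m 1,
      Nat.choose_one_right, add_comm]

theorem choose_two_add (a b : ℕ) : (a + b).choose 2 = a.choose 2 + b.choose 2 + a * b := by
  induction b with
  | zero => simp
  | succ b ih =>
    rw [← add_assoc, Nat.choose_succ_succ' (a + b) 1, ih, Nat.choose_succ_succ' b 1]
    simp only [Nat.choose_one_right]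
    ring

/-- Each pair of letters, read from left to right, contributes one value of ψ. The pairs of x's
number `(a + b).choose 2` wherever y stands, so for fixed a + b only the last two factors depend on
the position of y. -/
theorem pow_mul_pow {g h : G} {x y : B} (hx : x ∈ 𝒜 g) (hy : y ∈ 𝒜 h) (a b : ℕ) :
    of 𝒜 ψ x ^ a * of 𝒜 ψ y * of 𝒜 ψ x ^ b =
      ((ψ g g ^ (a + b).choose 2 * ψ g h ^ a * ψ h g ^ b : Kˣ) : K) •
        of 𝒜 ψ (x ^ a * y * x ^ b) := by
  rw [pow_of 𝒜 ψ hx, pow_of 𝒜 ψ hx, smul_mul_assoc, of_mul_of 𝒜 ψ (SetLike.pow_mem_graded a hx) hy,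
    smul_mul_assoc, smul_mul_assoc, mul_smul_comm,
    of_mul_of 𝒜 ψ (SetLike.mul_mem_graded (SetLike.pow_mem_graded a hx) hy)
      (SetLike.pow_mem_graded b hx)]
  simp only [smul_smul, ← Units.val_mul, ψ.add_left, ψ.nsmul_left, ψ.nsmul_right]
  congr 2
  rw [choose_two_add, pow_add, pow_add, mul_comm a b, pow_mul]
  ac_rfl

-- The scalar is a unit, so words in the twist and words in `B` span each other; this gives both
-- directions of `of_mem_adjoin_iff`.
variable {𝒜} in
theorem prod_map_of {X : Type*} {g : X → B} {deg : X → G} (hg : ∀ x, g x ∈ 𝒜 (deg x))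
    (w : List X) : (w.map g).prod ∈ 𝒜 (w.map deg).sum ∧
      ∃ c : Kˣ, (w.map fun x => of 𝒜 ψ (g x)).prod = (c : K) • of 𝒜 ψ (w.map g).prod := by
  induction w with
  | nil => exact ⟨by simpa using SetLike.GradedOne.one_mem, 1, by simp [one_def]⟩
  | cons a w ih =>
    obtain ⟨hw, c, hc⟩ := ih
    simp only [List.map_cons, List.prod_cons, List.sum_cons]
    refine ⟨SetLike.mul_mem_graded (hg a) hw, c * ψ (deg a) (w.map deg).sum, ?_⟩
    rw [hc, mul_smul_comm, of_mul_of 𝒜 ψ (hg a) hw, smul_smul, Units.val_mul]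

/-- A subalgebra generated by homogeneous elements generates the same subspace of the twist. -/
theorem of_mem_adjoin_iff {X : Type*} {g : X → B} {deg : X → G} (hg : ∀ x, g x ∈ 𝒜 (deg x))
    (x : B) : of 𝒜 ψ x ∈ Algebra.adjoin K (Set.range fun i => of 𝒜 ψ (g i)) ↔
      x ∈ Algebra.adjoin K (Set.range g) := by
  have words {C : Type _} [Ring C] [Algebra K C] (h : X → C) (w : List X) :
      (w.map h).prod ∈ Algebra.adjoin K (Set.range h) :=
    list_prod_mem fun y hy => by
      obtain ⟨i, -, rfl⟩ := List.mem_map.mp hy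
      exact Algebra.subset_adjoin ⟨i, rfl⟩
  have lists {C : Type _} [Ring C] [Algebra K C] (h : X → C) (y : C)
      (hy : y ∈ Submonoid.closure (Set.range h)) : ∃ w : List X, (w.map h).prod = y := by
    obtain ⟨l, hl, rfl⟩ := Submonoid.exists_list_of_mem_closure hy
    obtain ⟨w, rfl⟩ : l ∈ Set.range (List.map h) := by
      rw [Set.range_list_map]; exact hl
    exact ⟨w, rfl⟩
  constructor
  · intro hx
    have key : ∀ y ∈ Algebra.adjoin K (Set.range fun i => of 𝒜 ψ (g i)),
        (of 𝒜 ψ).symm y ∈ Algebra.adjoin K (Set.range g) := by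
      intro y hy
      rw [← Subalgebra.mem_toSubmodule, Algebra.adjoin_eq_span] at hy
      induction hy using Submodule.span_induction with
      | zero => simp
      | add a b _ _ ha hb => rw [map_add]; exact add_mem ha hb
      | smul c a _ ha => rw [map_smul]; exact Subalgebra.smul_mem _ ha c
      | mem y hy =>
        obtain ⟨w, rfl⟩ := lists _ y hy
        obtain ⟨-, c, hc⟩ := prod_map_of ψ hg w
        rw [hc, map_smul, LinearEquiv.symm_apply_apply]
        exact Subalgebra.smul_mem _ (words g w) _
    simpa using key _ hx
  · intro hx
    rw [← Subalgebra.mem_toSubmodule, Algebra.adjoin_eq_span] at hx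
    induction hx using Submodule.span_induction with
    | zero => simp
    | add a b _ _ ha hb => rw [map_add]; exact add_mem ha hb
    | smul c a _ ha => rw [map_smul]; exact Subalgebra.smul_mem _ ha c
    | mem y hy =>
      obtain ⟨w, rfl⟩ := lists _ y hy
      obtain ⟨-, c, hc⟩ := prod_map_of ψ hg w
      have : of 𝒜 ψ (w.map g).prod = ((c⁻¹ : Kˣ) : K) • (w.map fun x => of 𝒜 ψ (g x)).prod := by
        rw [hc, smul_smul, ← Units.val_mul, inv_mul_cancel, Units.val_one, one_smul]
      rw [this]
      exact Subalgebra.smul_mem _ (words _ w) _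

end GradedTwist

/-! ### Comparison of two parameter pairs, and generators in the twist -/

section Hom

variable {K : Type*} [Field K] {n : ℕ}
variable (A : Matrix (Fin n) (Fin n) ℤ) (d : Fin n → ℕ) (r s r' s' : K)
  (ζ : Bicharacter (RootLattice n) K)

/-- The parameters `(r, s)`, `(r', s')` have the same ratios `rᵢ / sᵢ`, and the skew bicharacter
`ζ` relates the remaining structure constants of `U_{r,s}` and `U_{r',s'}`. -/
structure TwistCompat : Prop where
  r_ne : r ≠ 0
  s_ne : s ≠ 0
  r_ne' : r' ≠ 0
  s_ne' : s' ≠ 0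
  ratio : ∀ i, r ^ d i / s ^ d i = r' ^ d i / s' ^ d i
  ratio_ne : ∀ i, r ^ d i / s ^ d i ≠ 1
  skew : ζ.IsSkew
  sq : ∀ i j, ((ζ (α i) (α j) : Kˣ) : K) ^ 2 * (r' ^ euler A d j i * s' ^ (-euler A d i j)) =
    r ^ euler A d j i * s ^ (-euler A d i j)

variable {A d r s r' s' ζ}

/-- This symmetry is the reason for allowing two arbitrary pairs instead of fixing (q, q⁻¹): the
inverse map is an instance of the same construction. -/
theorem TwistCompat.symm (h : TwistCompat A d r s r' s' ζ) :
    TwistCompat A d r' s' r s ζ.inv where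
  r_ne := h.r_ne'
  s_ne := h.s_ne'
  r_ne' := h.r_ne
  s_ne' := h.s_ne
  ratio i := (h.ratio i).symm
  ratio_ne i := h.ratio i ▸ h.ratio_ne i
  skew := h.skew.inv
  sq i j := by
    rw [← h.sq i j, ← mul_assoc, Bicharacter.inv_apply, ← mul_pow, ← Units.val_mul,
      inv_mul_cancel, Units.val_one, one_pow, one_mul]

theorem TwistCompat.swap (h : TwistCompat A d r s r' s' ζ) (i j : Fin n) :
    ζ (α j) (α i) = (ζ (α i) (α j))⁻¹ := h.skew.swap _ _

/-- The relations for ωᵢ' impose no further condition: invert `sq` for (j, i) and use that ζ is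
skew. -/
theorem TwistCompat.sq' (h : TwistCompat A d r s r' s' ζ) (i j : Fin n) :
    ((ζ (α i) (α j) : Kˣ) : K) ^ 2 * (r' ^ (-euler A d i j) * s' ^ euler A d j i) =
      r ^ (-euler A d i j) * s ^ euler A d j i := by
  have h1 := congrArg (·⁻¹) (h.sq j i)
  simp only [mul_inv, h.swap i j, Units.val_inv_eq_inv_val, inv_pow, inv_inv, ← zpow_neg,
    neg_neg] at h1
  exact h1

theorem TwistCompat.sq_inv (h : TwistCompat A d r s r' s' ζ) (i j : Fin n) :
    ((ζ (α j) (α i) : Kˣ) : K) ^ 2 * (r' ^ (-euler A d j i) * s' ^ euler A d i j) =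
      r ^ (-euler A d j i) * s ^ euler A d i j := h.sq' j i

/-- The scalar `rᵢ - sᵢ` is nonzero and `(r'ᵢ - s'ᵢ) / (rᵢ - sᵢ) = s'ᵢ / sᵢ`. -/
theorem TwistCompat.sub_inv (h : TwistCompat A d r s r' s' ζ) (i : Fin n) :
    s' ^ d i / s ^ d i * (r' ^ d i - s' ^ d i)⁻¹ = (r ^ d i - s ^ d i)⁻¹ := by
  have hs := pow_ne_zero (d i) h.s_ne
  have hs' := pow_ne_zero (d i) h.s_ne'
  have h1 := h.ratio i
  have h2 := h.ratio_ne i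
  have h3 := h.symm.ratio_ne i
  rw [Ne, div_eq_one_iff_eq hs, ← sub_eq_zero] at h2
  rw [Ne, div_eq_one_iff_eq hs', ← sub_eq_zero] at h3
  rw [div_eq_div_iff hs hs'] at h1
  field_simp
  linear_combination h1

/-- The binomial and the triangular power depend only on rᵢ/sᵢ, which the two pairs share; the
remaining factor is a k-th power, controlled by `sq`. -/
theorem TwistCompat.serreCoeff_eq (h : TwistCompat A d r s r' s' ζ) (i j : Fin n) (k : ℕ) :
    serreCoeff A d r s i j k =
      ((ζ (α i) (α j) : Kˣ) : K) ^ (2 * k) * serreCoeff A d r' s' i j k := by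
  have key := congrArg (· ^ k) (h.sq i j)
  simp only [mul_pow, ← pow_mul] at key
  have e (x : K) (m : ℤ) : x ^ ((k : ℤ) * m) = (x ^ m) ^ k := by
    rw [mul_comm, zpow_mul, zpow_natCast]
  unfold serreCoeff serreC
  simp only [← mul_neg, e]
  rw [← key, h.ratio i]
  ring

variable (A d r' s' ζ) in
/-- The generators of `U_{r',s'}` in the twist. -/
abbrev tgen (x : Gen n) : GradedTwist (bigrading A d r' s') ζ.double :=
  GradedTwist.of (bigrading A d r' s') ζ.double (gen A d r' s' x)

theorem gen_mem (x : Gen n) : gen A d r s x ∈ bigrading A d r s (bideg x) :=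
  wordSpan_gen (deg := bideg) x

theorem tgen_mul_tgen (x y : Gen n) : tgen A d r' s' ζ x * tgen A d r' s' ζ y =
    ((ζ.double (bideg x) (bideg y) : Kˣ) : K) •
      GradedTwist.of (bigrading A d r' s') ζ.double (gen A d r' s' x * gen A d r' s' y) :=
  GradedTwist.of_mul_of _ _ (gen_mem x) (gen_mem y)

/-- A `q`-commutation relation between generators in the twist. -/
theorem tgen_comm {x y : Gen n} {c c' : K}
    (h : gen A d r' s' x * gen A d r' s' y = c' • (gen A d r' s' y * gen A d r' s' x))
    (hc : ((ζ.double (bideg x) (bideg y) : Kˣ) : K) * c' =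
      c * ((ζ.double (bideg y) (bideg x) : Kˣ) : K)) :
    tgen A d r' s' ζ x * tgen A d r' s' ζ y = c • (tgen A d r' s' ζ y * tgen A d r' s' ζ x) := by
  rw [tgen_mul_tgen, tgen_mul_tgen, h, map_smul, smul_smul, smul_smul, hc]

theorem tgen_mul_eq_one {x y : Gen n} (h : gen A d r' s' x * gen A d r' s' y = 1)
    (hc : ζ.double (bideg x) (bideg y) = 1) : tgen A d r' s' ζ x * tgen A d r' s' ζ y = 1 := by
  rw [tgen_mul_tgen, h, hc, Units.val_one, one_smul, GradedTwist.one_def]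

variable (d s s') in
/-- The scalars by which the generators are rescaled: `s'ᵢ / sᵢ` for `fᵢ`, otherwise `1`. -/
def genScale : Gen n → K
  | .f i => s' ^ d i / s ^ d i
  | _ => 1

theorem genScale_mul_genScale (hs : s ≠ 0) (hs' : s' ≠ 0) (x : Gen n) :
    genScale d s s' x * genScale d s' s x = 1 := by
  cases x with
  | f i =>
    have := pow_ne_zero (d i) hs
    have := pow_ne_zero (d i) hs'
    simp only [genScale]
    field_simp
  | _ => simp [genScale]

variable (A d r s r' s' ζ) in
/-- The map on the free algebra inducing the homomorphism from `U_{r,s}` to the twist. -/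
def freeTwist : FreeAlgebra K (Gen n) →ₐ[K] GradedTwist (bigrading A d r' s') ζ.double :=
  FreeAlgebra.lift K fun x => genScale d s s' x • tgen A d r' s' ζ x

theorem freeTwist_ι (x : Gen n) : freeTwist A d s r' s' ζ (FreeAlgebra.ι K x) =
    genScale d s s' x • tgen A d r' s' ζ x := FreeAlgebra.lift_ι_apply _ _

end Hom

/-! ### The defining relations hold in the twist -/

section Hom

variable {K : Type*} [Field K] {n : ℕ}
variable {A : Matrix (Fin n) (Fin n) ℤ} {d : Fin n → ℕ} {r s r' s' : K}
  {ζ : Bicharacter (RootLattice n) K}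

/-- With N = 1 - aᵢⱼ, the powers of ζ(αᵢ, αⱼ) on the left are 2k from the coefficient, N - k, and -k
by skewness. Their sum N does not depend on k, so the twisted Serre sum is one scalar times the
untwisted one. The unit `z` is room for the common factor from the pairs of equal letters. -/
theorem TwistCompat.serre_twist (h : TwistCompat A d r s r' s' ζ) (i j : Fin n) (k : ℕ)
    (hk : k ≤ (1 - A i j).toNat) (z : Kˣ) :
    serreCoeff A d r s i j k * ((z * ζ (α i) (α j) ^ ((1 - A i j).toNat - k) *
      ζ (α j) (α i) ^ k : Kˣ) : K) =
    ((z * ζ (α i) (α j) ^ (1 - A i j).toNat : Kˣ) : K) * serreCoeff A d r' s' i j k := by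
  obtain ⟨m, hm⟩ := Nat.exists_eq_add_of_le hk
  have hz := (ζ (α i) (α j)).ne_zero
  rw [h.serreCoeff_eq, h.swap i j, hm, Nat.add_sub_cancel_left]
  simp only [Units.val_mul, Units.val_pow_eq_pow_val, Units.val_inv_eq_inv_val, inv_pow]
  field_simp
  ring

theorem double_skew_aux {z : Kˣ} {c c' : K} (h : (z : K) ^ 2 * c' = c) :
    (z : K) * c' = c * ((z⁻¹ : Kˣ) : K) := by
  have := z.ne_zero
  rw [← h, Units.val_inv_eq_inv_val]
  field_simp

theorem TwistCompat.freeTwist_rel (h : TwistCompat A d r s r' s' ζ)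
    {x y : FreeAlgebra K (Gen n)} (hxy : Rel A d r s x y) :
    freeTwist A d s r' s' ζ x = freeTwist A d s r' s' ζ y := by
  have rel {x y} (h : Rel A d r' s' x y) := mk_rel A d r' s' h
  cases hxy with
  -- On bidegrees ±(αᵢ, -αᵢ) the two factors of ζ~ cancel, so the group-like part is not twisted at
  -- all.
  | om_omInv i =>
    simp only [map_mul, map_one, freeTwist_ι, genScale, one_smul]
    exact tgen_mul_eq_one (by simpa [gen] using rel (.om_omInv i))
      (by simp [Bicharacter.double_apply, bideg, Bicharacter.neg_left, Bicharacter.neg_right])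
  | omInv_om i =>
    simp only [map_mul, map_one, freeTwist_ι, genScale, one_smul]
    exact tgen_mul_eq_one (by simpa [gen] using rel (.omInv_om i))
      (by simp [Bicharacter.double_apply, bideg, Bicharacter.neg_left, Bicharacter.neg_right])
  | omp_ompInv i =>
    simp only [map_mul, map_one, freeTwist_ι, genScale, one_smul]
    exact tgen_mul_eq_one (by simpa [gen] using rel (.omp_ompInv i))
      (by simp [Bicharacter.double_apply, bideg, Bicharacter.neg_left, Bicharacter.neg_right])
  | ompInv_omp i =>
    simp only [map_mul, map_one, freeTwist_ι, genScale, one_smul]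
    exact tgen_mul_eq_one (by simpa [gen] using rel (.ompInv_omp i))
      (by simp [Bicharacter.double_apply, bideg, Bicharacter.neg_left, Bicharacter.neg_right])
  | om_om i j =>
    simp only [map_mul, freeTwist_ι, genScale, one_smul]
    rw [← one_smul K (tgen A d r' s' ζ (.om j) * _)]
    exact tgen_comm (c' := 1) (by simpa [gen] using rel (.om_om i j))
      (by simp [Bicharacter.double_apply, bideg, Bicharacter.neg_left, Bicharacter.neg_right])
  | omp_omp i j =>
    simp only [map_mul, freeTwist_ι, genScale, one_smul]
    rw [← one_smul K (tgen A d r' s' ζ (.omp j) * _)]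
    exact tgen_comm (c' := 1) (by simpa [gen] using rel (.omp_omp i j))
      (by simp [Bicharacter.double_apply, bideg, Bicharacter.neg_left, Bicharacter.neg_right])
  | om_omp i j =>
    simp only [map_mul, freeTwist_ι, genScale, one_smul]
    rw [← one_smul K (tgen A d r' s' ζ (.omp j) * _)]
    exact tgen_comm (c' := 1) (by simpa [gen] using rel (.om_omp i j))
      (by simp [Bicharacter.double_apply, bideg, Bicharacter.neg_left, Bicharacter.neg_right])
  | om_e i j =>
    simp only [map_mul, map_smul, freeTwist_ι, genScale, one_smul]
    refine tgen_comm (by simpa only [gen, map_mul, map_smul] using rel (.om_e i j)) ?_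
    simp only [Bicharacter.double_apply, bideg, Bicharacter.zero_left, Bicharacter.zero_right,
      inv_one, mul_one, h.swap i j]
    exact double_skew_aux (h.sq i j)
  | omp_e i j =>
    simp only [map_mul, map_smul, freeTwist_ι, genScale, one_smul]
    refine tgen_comm (by simpa only [gen, map_mul, map_smul] using rel (.omp_e i j)) ?_
    simp only [Bicharacter.double_apply, bideg, Bicharacter.zero_left, Bicharacter.zero_right,
      inv_one, mul_one, h.swap i j]
    exact double_skew_aux (h.sq' i j)
  | om_f i j =>
    simp only [map_mul, map_smul, freeTwist_ι, genScale, one_smul, smul_mul_assoc, mul_smul_comm]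
    rw [smul_comm]
    congr 1
    refine tgen_comm (by simpa only [gen, map_mul, map_smul] using rel (.om_f i j)) ?_
    -- Only the second components pair nontrivially, and there ζ enters inverted; by skewness the
    -- scalar is ζ(αⱼ, αᵢ).
    simp only [Bicharacter.double_apply, bideg, Bicharacter.zero_left, Bicharacter.zero_right,
      Bicharacter.neg_left, Bicharacter.neg_right, inv_inv, one_mul, h.swap j i]
    exact double_skew_aux (h.sq_inv i j)
  | omp_f i j =>
    simp only [map_mul, map_smul, freeTwist_ι, genScale, one_smul, smul_mul_assoc, mul_smul_comm]
    rw [smul_comm]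
    congr 1
    refine tgen_comm (by simpa only [gen, map_mul, map_smul] using rel (.omp_f i j)) ?_
    simp only [Bicharacter.double_apply, bideg, Bicharacter.zero_left, Bicharacter.zero_right,
      Bicharacter.neg_left, Bicharacter.neg_right, inv_inv, one_mul, h.swap j i]
    exact double_skew_aux (h.sq j i)
  | e_f_same i =>
    have key : gen A d r' s' (.e i) * gen A d r' s' (.f i) -
        gen A d r' s' (.f i) * gen A d r' s' (.e i) =
        (r' ^ d i - s' ^ d i)⁻¹ • (gen A d r' s' (.om i) - gen A d r' s' (.omp i)) := by
      simpa only [gen, map_mul, map_smul, map_sub] using rel (.e_f_same i)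
    simp only [map_sub, map_mul, map_smul, freeTwist_ι, genScale, one_smul, smul_mul_assoc,
      mul_smul_comm]
    rw [tgen_mul_tgen, tgen_mul_tgen, ← smul_sub]
    simp only [Bicharacter.double_apply, bideg, Bicharacter.zero_left, Bicharacter.zero_right,
      inv_one, mul_one, Units.val_one, one_smul]
    -- The products of eᵢ and fᵢ are untwisted; the factor s'ᵢ/sᵢ attached to fᵢ corrects the
    -- denominator.
    rw [← map_sub, key, map_smul, smul_smul, h.sub_inv, map_sub]
  | e_f_ne i j hij =>
    have key : gen A d r' s' (.e i) * gen A d r' s' (.f j) -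
        gen A d r' s' (.f j) * gen A d r' s' (.e i) = 0 := by
      simpa only [gen, map_mul, map_zero, map_sub] using rel (.e_f_ne i j hij)
    simp only [map_sub, map_mul, map_zero, freeTwist_ι, genScale, one_smul, smul_mul_assoc,
      mul_smul_comm]
    rw [tgen_mul_tgen, tgen_mul_tgen, ← smul_sub]
    simp only [Bicharacter.double_apply, bideg, Bicharacter.zero_left, Bicharacter.zero_right,
      inv_one, mul_one, Units.val_one, one_smul]
    rw [← map_sub, key, map_zero, smul_zero]
  | serre_e i j hij =>
    have key := rel (.serre_e i j hij)
    simp only [map_sum, map_smul, map_mul, map_pow, map_zero] at key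
    simp only [map_sum, map_smul, map_mul, map_pow, map_zero, freeTwist_ι, genScale, one_smul]
    set z : Kˣ := ζ (α i) (α i) ^ (1 - A i j).toNat.choose 2
    -- Zero is rewritten as the common scalar times the image of the Serre relation of U_{r',s'}, so
    -- that the sums can be compared term by term.
    rw [← smul_zero ((z * ζ (α i) (α j) ^ (1 - A i j).toNat : Kˣ) : K),
      ← map_zero (GradedTwist.of (bigrading A d r' s') ζ.double), ← key, map_sum, Finset.smul_sum]
    refine Finset.sum_congr rfl fun k hk => ?_
    have hk' : k ≤ (1 - A i j).toNat := by simpa [Nat.lt_succ_iff] using hk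
    rw [GradedTwist.pow_mul_pow _ _ (gen_mem _) (gen_mem _), Nat.sub_add_cancel hk', map_smul,
      smul_smul, smul_smul, ← h.serre_twist i j k hk' z]
    simp only [Bicharacter.double_apply, bideg, Bicharacter.zero_left, inv_one, mul_one]
    rfl
  | serre_f i j hij =>
    have key := rel (.serre_f i j hij)
    simp only [map_sum, map_smul, map_mul, map_pow, map_zero] at key
    simp only [map_sum, map_smul, map_mul, map_pow, map_zero, freeTwist_ι, genScale, smul_pow]
    set N := (1 - A i j).toNat
    set c : K := s' ^ d i / s ^ d i
    set c' : K := s' ^ d j / s ^ d j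
    set z : Kˣ := ζ.double (bideg (.f i)) (bideg (.f i)) ^ N.choose 2
    -- Rescaling contributes c^N c' to every term, since fᵢ occurs N times and fⱼ once.
    rw [← smul_zero (c ^ N * c' * ((z * ζ (α i) (α j) ^ N : Kˣ) : K)),
      ← map_zero (GradedTwist.of (bigrading A d r' s') ζ.double), ← key, map_sum, Finset.smul_sum]
    refine Finset.sum_congr rfl fun k hk => ?_
    have hk' : k ≤ N := by simpa [Nat.lt_succ_iff] using hk
    -- On U⁻ the twist uses ζ⁻¹, which exchanges the roles of i and j. This compensates the reversed
    -- order of the Serre monomials, so `serre_twist` applies again.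
    have hij' : ζ.double (bideg (.f i)) (bideg (.f j)) = ζ (α j) (α i) := by
      simp [Bicharacter.double_apply, bideg, Bicharacter.zero_left, Bicharacter.neg_left,
        Bicharacter.neg_right, h.swap i j]
    have hji' : ζ.double (bideg (.f j)) (bideg (.f i)) = ζ (α i) (α j) := by
      simp [Bicharacter.double_apply, bideg, Bicharacter.zero_left, Bicharacter.neg_left,
        Bicharacter.neg_right, h.swap i j]
    simp only [smul_mul_assoc, mul_smul_comm, smul_smul]
    rw [GradedTwist.pow_mul_pow _ _ (gen_mem _) (gen_mem _), Nat.add_sub_cancel' hk', map_smul,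
      smul_smul, smul_smul, hij', hji', mul_right_comm z, mul_assoc (c ^ N * c'),
      ← h.serre_twist i j k hk' z]
    congr 1
    rw [← pow_mul_pow_sub c hk']
    ring

end Hom

/-! ### The isomorphism of bigraded algebras -/

section Equiv

variable {K : Type*} [Field K] {n : ℕ}
variable {A : Matrix (Fin n) (Fin n) ℤ} {d : Fin n → ℕ} {r s r' s' : K}
  {ζ : Bicharacter (RootLattice n) K}

/-- The homomorphism from `U_{r,s}` to the twist of `U_{r',s'}`. -/
def TwistCompat.hom (h : TwistCompat A d r s r' s' ζ) :
    U A d r s →ₐ[K] GradedTwist (bigrading A d r' s') ζ.double :=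
  RingQuot.liftAlgHom K ⟨freeTwist A d s r' s' ζ, fun _ _ hxy => h.freeTwist_rel hxy⟩

theorem TwistCompat.hom_gen (h : TwistCompat A d r s r' s' ζ) (x : Gen n) :
    h.hom (gen A d r s x) = genScale d s s' x • tgen A d r' s' ζ x := by
  rw [← freeTwist_ι]
  exact RingQuot.liftAlgHom_mkAlgHom_apply K _ _ _

/-- The linear map `U_{r,s} → U_{r',s'}` underlying `TwistCompat.hom`. -/
def TwistCompat.lin (h : TwistCompat A d r s r' s' ζ) : U A d r s →ₗ[K] U A d r' s' :=
  (GradedTwist.of (bigrading A d r' s') ζ.double).symm.toLinearMap ∘ₗ h.hom.toLinearMap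

theorem TwistCompat.of_lin (h : TwistCompat A d r s r' s' ζ) (x : U A d r s) :
    GradedTwist.of (bigrading A d r' s') ζ.double (h.lin x) = h.hom x := rfl

theorem TwistCompat.lin_one (h : TwistCompat A d r s r' s' ζ) : h.lin 1 = 1 := by
  apply (GradedTwist.of (bigrading A d r' s') ζ.double).injective
  rw [h.of_lin, map_one, GradedTwist.one_def]

theorem TwistCompat.lin_gen_mul (h : TwistCompat A d r s r' s' ζ) (x : Gen n) {y : U A d r s}
    {γ : RootLattice n × RootLattice n} (hy : h.lin y ∈ bigrading A d r' s' γ) :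
    h.lin (gen A d r s x * y) = (genScale d s s' x * (ζ.double (bideg x) γ : Kˣ)) •
      (gen A d r' s' x * h.lin y) := by
  apply (GradedTwist.of (bigrading A d r' s') ζ.double).injective
  rw [h.of_lin, map_mul, h.hom_gen, ← h.of_lin y, smul_mul_assoc,
    GradedTwist.of_mul_of _ _ (gen_mem x) hy, map_smul, smul_smul]

theorem TwistCompat.lin_word (h : TwistCompat A d r s r' s' ζ) (w : List (Gen n)) :
    h.lin (w.map (gen A d r s)).prod ∈ bigrading A d r' s' (w.map bideg).sum := by
  induction w with
  | nil => simpa [h.lin_one] using SetLike.GradedOne.one_mem (A := bigrading A d r' s')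
  | cons a w ih =>
    simp only [List.map_cons, List.prod_cons, List.sum_cons]
    rw [h.lin_gen_mul a ih]
    exact Submodule.smul_mem _ _ (SetLike.mul_mem_graded (gen_mem a) ih)

theorem TwistCompat.lin_mem (h : TwistCompat A d r s r' s' ζ)
    {γ : RootLattice n × RootLattice n} {x : U A d r s} (hx : x ∈ bigrading A d r s γ) :
    h.lin x ∈ bigrading A d r' s' γ := by
  have : bigrading A d r s γ ≤ (bigrading A d r' s' γ).comap h.lin := by
    refine Submodule.span_le.mpr ?_
    rintro _ ⟨w, rfl, rfl⟩
    exact h.lin_word w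
  exact this hx

/-- Both maps preserve bidegrees, so a given letter meets ζ~ and ζ~⁻¹ at the same arguments, and the
two rescalings are mutually inverse. Working with underlying linear maps avoids twisting a twist. -/
theorem TwistCompat.lin_lin_word (h : TwistCompat A d r s r' s' ζ) (w : List (Gen n)) :
    h.symm.lin (h.lin (w.map (gen A d r s)).prod) = (w.map (gen A d r s)).prod := by
  induction w with
  | nil => simp [TwistCompat.lin_one]
  | cons a w ih =>
    have hw := h.lin_word w
    simp only [List.map_cons, List.prod_cons]
    rw [h.lin_gen_mul a hw, map_smul, h.symm.lin_gen_mul a (h.symm.lin_mem hw), ih, smul_smul]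
    have : ζ.inv.double (bideg a) (w.map bideg).sum = (ζ.double (bideg a) (w.map bideg).sum)⁻¹ := by
      simp [Bicharacter.double_apply, Bicharacter.inv_apply, mul_comm]
    rw [this, mul_mul_mul_comm, genScale_mul_genScale h.s_ne h.s_ne', one_mul, ← Units.val_mul,
      mul_inv_cancel, Units.val_one, one_smul]

theorem TwistCompat.lin_lin (h : TwistCompat A d r s r' s' ζ) (x : U A d r s) :
    h.symm.lin (h.lin x) = x := by
  have key (γ) : bigrading A d r s γ ≤ LinearMap.eqLocus (h.symm.lin ∘ₗ h.lin) LinearMap.id := by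
    refine Submodule.span_le.mpr ?_
    rintro _ ⟨w, rfl, rfl⟩
    exact h.lin_lin_word w
  induction x using DirectSum.Decomposition.inductionOn (bigrading A d r s) with
  | zero => simp
  | add a b ha hb => rw [map_add, map_add, ha, hb]
  | @homogeneous γ x => exact key γ x.2

theorem TwistCompat.lin_lin' (h : TwistCompat A d r s r' s' ζ) (x : U A d r' s') :
    h.lin (h.symm.lin x) = x := by
  -- `h.symm.symm` involves `ζ.inv.inv` in place of ζ, so the linear map has to be transported along
  -- this equality.
  have e : ζ.inv.inv = ζ := by
    cases ζ
    simp [Bicharacter.inv]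
  have key {ξ : Bicharacter (RootLattice n) K} (hξ : ξ = ζ) (h' : TwistCompat A d r s r' s' ξ) :
      h'.lin = h.lin := by
    subst hξ
    rfl
  rw [← key e h.symm.symm]
  exact h.symm.lin_lin x

/-- The isomorphism from `U_{r,s}` to the twist of `U_{r',s'}`. -/
def TwistCompat.equiv (h : TwistCompat A d r s r' s' ζ) :
    U A d r s ≃ₐ[K] GradedTwist (bigrading A d r' s') ζ.double :=
  AlgEquiv.ofBijective h.hom
    ⟨fun x y hxy => by
      rw [← h.lin_lin x, ← h.lin_lin y]
      exact congrArg h.symm.lin hxy,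
    fun y => ⟨h.symm.lin ((GradedTwist.of (bigrading A d r' s') ζ.double).symm y),
      h.lin_lin' _⟩⟩

theorem TwistCompat.equiv_gen (h : TwistCompat A d r s r' s' ζ) (x : Gen n) :
    h.equiv (gen A d r s x) = genScale d s s' x • tgen A d r' s' ζ x := h.hom_gen x

theorem TwistCompat.equiv_mem_piece (h : TwistCompat A d r s r' s' ζ)
    (γ : RootLattice n × RootLattice n) (x : U A d r s) :
    h.equiv x ∈ GradedTwist.piece (bigrading A d r' s') ζ.double γ ↔ x ∈ bigrading A d r s γ := by
  change GradedTwist.of _ _ (h.lin x) ∈ _ ↔ _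
  rw [GradedTwist.of_mem_piece]
  exact ⟨fun hx => h.lin_lin x ▸ h.symm.lin_mem hx, h.lin_mem⟩

theorem TwistCompat.map_bigrading (h : TwistCompat A d r s r' s' ζ)
    (γ : RootLattice n × RootLattice n) : (bigrading A d r s γ).map h.equiv.toLinearMap =
      GradedTwist.piece (bigrading A d r' s') ζ.double γ := by
  ext y
  obtain ⟨x, rfl⟩ := h.equiv.surjective y
  rw [h.equiv_mem_piece]
  exact ⟨fun ⟨x', hx', e⟩ => h.equiv.injective e ▸ hx', fun hx => ⟨x, hx, rfl⟩⟩

end Equiv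

/-! ### Scalars of conjugation by group-like elements -/

section ConjWeight

variable {K B : Type*} [Field K] [Ring B] [Algebra K B] {n : ℕ}

/-- The unit `g` commutes with `x` up to the scalar `c`. -/
def ConjWeight (g : Bˣ) (c : Kˣ) (x : B) : Prop := (g : B) * x = (c : K) • (x * g)

theorem ConjWeight.mul {g : Bˣ} {c c' : Kˣ} {x y : B} (hx : ConjWeight g c x)
    (hy : ConjWeight g c' y) : ConjWeight g (c * c') (x * y) := by
  unfold ConjWeight at *
  rw [← mul_assoc, hx, smul_mul_assoc, mul_assoc x, hy, mul_smul_comm, smul_smul, mul_assoc x,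
    Units.val_mul]

theorem ConjWeight.one (g : Bˣ) : ConjWeight g (1 : Kˣ) (1 : B) := by
  simp [ConjWeight]

theorem ConjWeight.one_left (x : B) : ConjWeight (1 : Bˣ) (1 : Kˣ) x := by
  simp [ConjWeight]

theorem ConjWeight.mul_left {g g' : Bˣ} {c c' : Kˣ} {x : B} (h : ConjWeight g c x)
    (h' : ConjWeight g' c' x) : ConjWeight (g * g') (c * c') x := by
  unfold ConjWeight at *
  rw [Units.val_mul, mul_assoc, h', mul_smul_comm, ← mul_assoc, h, smul_mul_assoc, smul_smul,
    mul_assoc, Units.val_mul, mul_comm (c : K)]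

theorem ConjWeight.inv {g : Bˣ} {c : Kˣ} {x : B} (h : ConjWeight g c x) :
    ConjWeight g⁻¹ c⁻¹ x := by
  unfold ConjWeight at *
  rw [Units.inv_mul_eq_iff_eq_mul, mul_smul_comm, ← mul_assoc, h, smul_mul_assoc, smul_smul,
    Units.mul_inv_cancel_right, ← Units.val_mul, inv_mul_cancel, Units.val_one, one_smul]

theorem ConjWeight.zpow {g : Bˣ} {c : Kˣ} {x : B} (h : ConjWeight g c x) (m : ℤ) :
    ConjWeight (g ^ m) (c ^ m) x := by
  induction m with
  | zero => simpa using ConjWeight.one_left x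
  | succ m ih => rw [zpow_add_one, zpow_add_one]; exact ih.mul_left h
  | pred m ih => rw [zpow_sub_one, zpow_sub_one]; exact ih.mul_left h.inv

/-- Needed for ωᵢ⁻¹ and ωᵢ'⁻¹, whose commutation with other generators is not among the defining
relations. -/
theorem conjWeight_of_mul_eq {g : Bˣ} {c : Kˣ} {x y : B} (h : ConjWeight g c x)
    (hx : x * y = 1) (hy : y * x = 1) : ConjWeight g c⁻¹ y := by
  unfold ConjWeight at *
  have : (c : K) • (x * (g * y)) = (c : K) • (x * ((c⁻¹ : Kˣ) : K) • (y * g)) := by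
    rw [← mul_assoc x, ← smul_mul_assoc, ← h, mul_smul_comm, smul_smul, ← Units.val_mul,
      mul_inv_cancel, ← mul_assoc, hx, mul_assoc, hx]
    simp
  have h2 := congrArg (y * ·) (smul_right_injective B c.ne_zero this)
  simpa only [← mul_assoc, hy, one_mul] using h2

/-- `∏ᵢ uᵢ ^ μᵢ`. -/
def powProd (u : Fin n → Bˣ) (μ : RootLattice n) : Bˣ := (List.ofFn fun i => u i ^ μ i).prod

/-- Commutativity enters because the product is an ordered one over a list. -/
theorem powProd_neg (u : Fin n → Bˣ) (hu : ∀ i j, Commute (u i) (u j)) (μ : RootLattice n) :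
    powProd u (-μ) = (powProd u μ)⁻¹ := by
  rw [eq_inv_iff_mul_eq_one]
  unfold powProd
  rw [List.ofFn_eq_map, List.ofFn_eq_map]
  induction List.finRange n with
  | nil => simp
  | cons a w ih =>
    simp only [List.map_cons, List.prod_cons]
    have hc : Commute (u a ^ μ a) ((w.map fun i => u i ^ (-μ) i).prod) :=
      Commute.list_prod_right _ _ fun y hy => by
        obtain ⟨i, -, rfl⟩ := List.mem_map.mp hy
        exact (hu a i).zpow_zpow _ _
    rw [mul_assoc, ← mul_assoc _ (u a ^ μ a), ← hc.eq, mul_assoc (u a ^ μ a), ih]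
    simp

variable (ψ : Bicharacter (RootLattice n) K)

theorem Bicharacter.zsmul_right {G : Type*} [AddCommGroup G] (ψ : Bicharacter G K) (m : ℤ)
    (a b : G) : ψ a (m • b) = ψ a b ^ m := by
  induction m with
  | zero => rw [zero_smul, ψ.zero_right, zpow_zero]
  | succ m ih => rw [add_smul, one_smul, ψ.add_right, ih, zpow_add_one]
  | pred m ih => rw [sub_smul, one_smul, sub_eq_add_neg, ψ.add_right, ih, ψ.neg_right, zpow_sub_one]

theorem ConjWeight.powProd {u : Fin n → Bˣ} {γ : RootLattice n} {x : B}
    (h : ∀ i, ConjWeight (u i) (ψ γ (α i)) x) (μ : RootLattice n) :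
    ConjWeight (powProd u μ) (ψ γ μ) x := by
  -- μ is expanded in simple roots along the list that orders the product, so that one induction
  -- treats both.
  have e : μ = ((List.finRange n).map fun i => μ i • α i).sum := by
    rw [← List.ofFn_eq_map, List.sum_ofFn]
    ext j
    simp [α, Pi.single_apply]
  have key (w : List (Fin n)) : ConjWeight (w.map fun i => u i ^ μ i).prod
      (ψ γ (w.map fun i => μ i • α i).sum) x := by
    induction w with
    | nil => simpa [ψ.zero_right] using ConjWeight.one_left x
    | cons a w ih =>
      simp only [List.map_cons, List.prod_cons, List.sum_cons]
      rw [ψ.add_right, ψ.zsmul_right]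
      exact ((h a).zpow _).mul_left ih
  have := key (List.finRange n)
  rw [← e] at this
  rwa [TwoParam.powProd, List.ofFn_eq_map]

/-- Weights multiply along a word and ψ is additive in its first argument, so words of equal degree
share one weight, which passes to their span. -/
theorem ConjWeight.wordSpan {X G : Type*} [AddCommGroup G] {g : X → B} {deg : X → G}
    (t : G →+ RootLattice n) {u : Fin n → Bˣ}
    (h : ∀ i x, ConjWeight (u i) (ψ (t (deg x)) (α i)) (g x)) (μ : RootLattice n) {γ : G} {x : B}
    (hx : x ∈ wordSpan K g deg γ) : ConjWeight (TwoParam.powProd u μ) (ψ (t γ) μ) x := by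
  induction hx using Submodule.span_induction with
  | zero => simp [ConjWeight]
  | add a b _ _ ha hb =>
    unfold ConjWeight at *
    rw [mul_add, add_mul, smul_add, ha, hb]
  | smul c a _ ha =>
    unfold ConjWeight at *
    rw [mul_smul_comm, ha, smul_mul_assoc, smul_comm]
  | mem x hx =>
    obtain ⟨w, rfl, rfl⟩ := hx
    induction w with
    | nil => simpa [ψ.zero_left] using ConjWeight.one _
    | cons a w ih =>
      simp only [List.map_cons, List.prod_cons, List.sum_cons]
      rw [map_add, ψ.add_left]
      exact (ConjWeight.powProd ψ (fun i => h i a) μ).mul ih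

end ConjWeight

/-! ### The Euler form and its characters -/

section EulerForm

variable {n : ℕ} (A : Matrix (Fin n) (Fin n) ℤ) (d : Fin n → ℕ)

theorem eulerForm_add_left (a b c : RootLattice n) :
    eulerForm A d (a + b) c = eulerForm A d a c + eulerForm A d b c := by
  simp [eulerForm, add_mul, Finset.sum_add_distrib]

theorem eulerForm_add_right (a b c : RootLattice n) :
    eulerForm A d a (b + c) = eulerForm A d a b + eulerForm A d a c := by
  simp [eulerForm, mul_add, add_mul, Finset.sum_add_distrib]

theorem eulerForm_α (i j : Fin n) : eulerForm A d (α i) (α j) = euler A d i j := by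
  simp [eulerForm, α, Pi.single_apply]

variable {A d}

theorem IsSimpleCartan.euler_add_euler (hA : IsSimpleCartan A d) (i j : Fin n) :
    euler A d i j + euler A d j i = d i * A i j := by
  unfold euler
  rcases lt_trichotomy i j with h | rfl | h
  · simp [h, h.not_gt, h.ne']
  · simp [hA.diag]; ring
  · simp [h, h.not_gt, h.ne', hA.symm i j]

/-- Symmetrizing the Euler form gives dᵢaᵢⱼ, so 2⟨μ, μ⟩ is the positive definite form of the Cartan
matrix. -/
theorem IsSimpleCartan.eulerForm_self_pos (hA : IsSimpleCartan A d) {μ : RootLattice n}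
    (hμ : μ ≠ 0) : 0 < eulerForm A d μ μ := by
  have h1 : 2 * eulerForm A d μ μ = ∑ i, ∑ j, μ i * μ j * (d i * A i j) := by
    have h2 : eulerForm A d μ μ = ∑ i, ∑ j, μ i * μ j * euler A d j i := by
      rw [eulerForm, Finset.sum_comm]
      simp only [mul_comm (μ _) (μ _)]
    rw [two_mul]
    nth_rewrite 2 [h2]
    simp only [eulerForm, ← Finset.sum_add_distrib, ← mul_add, hA.euler_add_euler]
  have := hA.posDef μ hμ
  omega

variable (A d) {K : Type*} [Field K]

/-- The bicharacter `r^⟨γ,μ⟩ s^{-⟨μ,γ⟩}`. -/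
def eulerChar (r s : Kˣ) : Bicharacter (RootLattice n) K where
  toFun γ μ := r ^ eulerForm A d γ μ * s ^ (-eulerForm A d μ γ)
  add_left a b c := by
    simp only [eulerForm_add_left, eulerForm_add_right, neg_add, zpow_add]
    exact mul_mul_mul_comm _ _ _ _
  add_right a b c := by
    simp only [eulerForm_add_left, eulerForm_add_right, neg_add, zpow_add]
    exact mul_mul_mul_comm _ _ _ _

theorem eulerChar_apply (r s : Kˣ) (γ μ : RootLattice n) : eulerChar A d r s γ μ =
    r ^ eulerForm A d γ μ * s ^ (-eulerForm A d μ γ) := rfl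

variable {A d}

/-- The weights separate the elements of the root lattice. -/
theorem IsSimpleCartan.eulerChar_injective (hA : IsSimpleCartan A d) {r s : Kˣ}
    (hrs : ∀ m : ℕ, 0 < m → (r / s) ^ m ≠ 1) {β γ : RootLattice n}
    (h : ∀ μ, eulerChar A d r s β μ = eulerChar A d r s γ μ) : β = γ := by
  by_contra hne
  have hpos := hA.eulerForm_self_pos (sub_ne_zero.mpr hne)
  -- Test the characters on the difference itself: there their quotient is (r/s)^⟨μ,μ⟩, a positive
  -- power of r/s.
  set μ := β - γ with hμ
  have hβ : β = μ + γ := by rw [hμ, sub_add_cancel]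
  have e := h μ
  rw [hβ, Bicharacter.add_left, mul_eq_right, eulerChar_apply] at e
  obtain ⟨m, hm⟩ := Int.eq_ofNat_of_zero_le hpos.le
  rw [hm] at e hpos
  refine hrs m (by omega) ?_
  rw [div_pow, div_eq_mul_inv]
  simpa using e

end EulerForm

/-! ### Weight spaces and graded components -/

section Weight

variable {K : Type*} [Field K] {n : ℕ}
variable (A : Matrix (Fin n) (Fin n) ℤ) (d : Fin n → ℕ) (r s : Kˣ)

/-- The total degree `Q × Q → Q`. -/
def totalDegree (n : ℕ) : RootLattice n × RootLattice n →+ RootLattice n :=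
  AddMonoidHom.fst _ _ + AddMonoidHom.snd _ _

theorem totalDegree_apply (γ : RootLattice n × RootLattice n) :
    totalDegree n γ = γ.1 + γ.2 := rfl

theorem omMu_eq (μ : RootLattice n) :
    omMu A d (r : K) s μ = powProd (omUnit A d (r : K) s) μ := rfl

theorem ompMu_eq (μ : RootLattice n) :
    ompMu A d (r : K) s μ = powProd (ompUnit A d (r : K) s) μ := rfl

theorem omUnit_commute (i j : Fin n) :
    Commute (omUnit A d (r : K) s i) (omUnit A d (r : K) s j) :=
  Units.ext (by simpa [gen, omUnit] using mk_rel A d (r : K) s (.om_om i j))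

theorem ompUnit_commute (i j : Fin n) :
    Commute (ompUnit A d (r : K) s i) (ompUnit A d (r : K) s j) :=
  Units.ext (by simpa [gen, ompUnit] using mk_rel A d (r : K) s (.omp_omp i j))

/-- The weight depends only on the total degree: fⱼ is opposite to eⱼ, and all group-like generators
have total degree 0. -/
theorem conjWeight_gen_of {ψ : Bicharacter (RootLattice n) K} {g : (U A d (r : K) (s : K))ˣ}
    {μ : RootLattice n}
    (he : ∀ j, ConjWeight g (ψ (α j) μ) (gen A d (r : K) s (.e j)))
    (hf : ∀ j, ConjWeight g (ψ (α j) μ)⁻¹ (gen A d (r : K) s (.f j)))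
    (hom : ∀ j, ConjWeight g (1 : Kˣ) (gen A d (r : K) s (.om j)))
    (homp : ∀ j, ConjWeight g (1 : Kˣ) (gen A d (r : K) s (.omp j))) (x : Gen n) :
    ConjWeight g (ψ (totalDegree n (bideg x)) μ) (gen A d (r : K) s x) := by
  cases x with
  | e j => simpa [totalDegree_apply, bideg] using he j
  | f j => simpa [totalDegree_apply, bideg, ψ.neg_left] using hf j
  | om j => simpa [totalDegree_apply, bideg, ψ.zero_left] using hom j
  | omp j => simpa [totalDegree_apply, bideg, ψ.zero_left] using homp j
  | omInv j =>
    have h := conjWeight_of_mul_eq (y := gen A d (r : K) s (.omInv j)) (hom j)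
      (omUnit A d (r : K) s j).val_inv
      (omUnit A d (r : K) s j).inv_val
    rw [inv_one] at h
    simpa only [totalDegree_apply, bideg, neg_add_cancel, ψ.zero_left] using h
  | ompInv j =>
    have h := conjWeight_of_mul_eq (y := gen A d (r : K) s (.ompInv j)) (homp j)
      (ompUnit A d (r : K) s j).val_inv
      (ompUnit A d (r : K) s j).inv_val
    rw [inv_one] at h
    simpa only [totalDegree_apply, bideg, neg_add_cancel, ψ.zero_left] using h

theorem omUnit_conjWeight (i : Fin n) (x : Gen n) : ConjWeight (omUnit A d (r : K) s i)
    (eulerChar A d r s (totalDegree n (bideg x)) (α i)) (gen A d (r : K) s x) := by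
  refine conjWeight_gen_of A d r s (fun j => ?_) (fun j => ?_) (fun j => ?_) (fun j => ?_) x
  · simpa [ConjWeight, eulerChar_apply, eulerForm_α, gen, omUnit] using
      mk_rel A d (r : K) s (.om_e i j)
  · simpa [ConjWeight, eulerChar_apply, eulerForm_α, gen, omUnit, mul_comm] using
      mk_rel A d (r : K) s (.om_f i j)
  · simpa [ConjWeight, gen, omUnit] using mk_rel A d (r : K) s (.om_om i j)
  · simpa [ConjWeight, gen, omUnit] using mk_rel A d (r : K) s (.om_omp i j)

/-- Passing from ω to ω' exchanges r and s in the character. -/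
theorem ompUnit_conjWeight (i : Fin n) (x : Gen n) : ConjWeight (ompUnit A d (r : K) s i)
    (eulerChar A d s r (totalDegree n (bideg x)) (α i)) (gen A d (r : K) s x) := by
  refine conjWeight_gen_of A d r s (fun j => ?_) (fun j => ?_) (fun j => ?_) (fun j => ?_) x
  · simpa [ConjWeight, eulerChar_apply, eulerForm_α, gen, ompUnit, mul_comm] using
      mk_rel A d (r : K) s (.omp_e i j)
  · simpa [ConjWeight, eulerChar_apply, eulerForm_α, gen, ompUnit] using
      mk_rel A d (r : K) s (.omp_f i j)
  · simpa [ConjWeight, gen, ompUnit] using (mk_rel A d (r : K) s (.om_omp j i)).symm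
  · simpa [ConjWeight, gen, ompUnit] using mk_rel A d (r : K) s (.omp_omp i j)

theorem omMu_conj {γ : RootLattice n × RootLattice n} {x : U A d (r : K) (s : K)}
    (hx : x ∈ bigrading A d (r : K) s γ) (μ : RootLattice n) :
    omMu A d (r : K) s μ * x * omMu A d (r : K) s (-μ) =
      ((eulerChar A d r s (totalDegree n γ) μ : Kˣ) : K) • x := by
  have h := ConjWeight.wordSpan (eulerChar A d r s) (totalDegree n) (omUnit_conjWeight A d r s) μ hx
  rw [omMu_eq, omMu_eq, powProd_neg _ (omUnit_commute A d r s), h, smul_mul_assoc,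
    Units.mul_inv_cancel_right]

theorem ompMu_conj {γ : RootLattice n × RootLattice n} {x : U A d (r : K) (s : K)}
    (hx : x ∈ bigrading A d (r : K) s γ) (μ : RootLattice n) :
    ompMu A d (r : K) s μ * x * ompMu A d (r : K) s (-μ) =
      ((eulerChar A d s r (totalDegree n γ) μ : Kˣ) : K) • x := by
  have h := ConjWeight.wordSpan (eulerChar A d s r) (totalDegree n) (ompUnit_conjWeight A d r s) μ
    hx
  rw [ompMu_eq, ompMu_eq, powProd_neg _ (ompUnit_commute A d r s), h, smul_mul_assoc,
    Units.mul_inv_cancel_right]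

/-- Conjugation by ω_μ is diagonal for the bigrading. No analogue for ω' is needed, as the
characters of the ω_μ already separate the weights. -/
theorem proj_omMu_conj (x : U A d (r : K) (s : K)) (δ : RootLattice n × RootLattice n)
    (μ : RootLattice n) :
    GradedRing.proj (bigrading A d (r : K) s) δ
        (omMu A d (r : K) s μ * x * omMu A d (r : K) s (-μ)) =
      ((eulerChar A d r s (totalDegree n δ) μ : Kˣ) : K) •
        GradedRing.proj (bigrading A d (r : K) s) δ x := by
  induction x using DirectSum.Decomposition.inductionOn (bigrading A d (r : K) s) with
  | zero => simp
  | add a b ha hb => rw [mul_add, add_mul, map_add, ha, hb, map_add, smul_add]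
  | @homogeneous γ x =>
    rw [omMu_conj A d r s x.2]
    simp only [GradedRing.proj_apply, DirectSum.decompose_smul, DirectSum.smul_apply,
      Submodule.coe_smul]
    by_cases hδ : γ = δ
    · subst hδ; rfl
    · rw [DirectSum.decompose_of_mem_ne _ x.2 hδ, smul_zero, smul_zero]

/-- The weight spaces of a subalgebra which is graded via a section `j` of the total degree are
its graded components. -/
theorem weightSpace_eq_subGrading (hA : IsSimpleCartan A d)
    (hrs : ∀ m : ℕ, 0 < m → (r / s) ^ m ≠ 1)
    (S : Subalgebra K (U A d (r : K) (s : K))) (j : RootLattice n →+ RootLattice n × RootLattice n)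
    (hj : ∀ β, totalDegree n (j β) = β)
    [GradedAlgebra (subGrading (bigrading A d (r : K) s) S j)] (γ : RootLattice n) :
    weightSpace A d (r : K) s S γ = subGrading (bigrading A d (r : K) s) S j γ := by
  ext x
  constructor
  · intro hx
    -- Weights see only the total degree, which does not separate bidegrees; inside `S`, however,
    -- only the bidegrees `j β` occur, and on these the total degree is injective.
    have hout : ∀ y : S, ∀ δ ∉ Set.range j,
        GradedRing.proj (bigrading A d (r : K) s) δ (y : U A d (r : K) (s : K)) = 0 := by
      intro y δ hδ
      induction y using DirectSum.Decomposition.inductionOn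
        (subGrading (bigrading A d (r : K) s) S j) with
      | zero => simp
      | add a b ha hb => rw [Subalgebra.coe_add, map_add, ha, hb, add_zero]
      | @homogeneous β y =>
        exact DirectSum.decompose_of_mem_ne (bigrading A d (r : K) s) (i := j β) y.2
          fun e => hδ ⟨β, e⟩
    have hzero : ∀ δ, δ ≠ j γ →
        GradedRing.proj (bigrading A d (r : K) s) δ (x : U A d (r : K) (s : K)) = 0 := by
      intro δ hδ
      by_cases hδ' : δ ∈ Set.range j
      · obtain ⟨β, rfl⟩ := hδ'
        by_contra hne
        refine hδ (congrArg j (hA.eulerChar_injective hrs fun μ => ?_))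
        -- Conjugation multiplies the component in degree `j β` by the character of β, while the
        -- hypothesis on `x` prescribes that of γ. A nonzero component forces the two to agree.
        have h1 := proj_omMu_conj A d r s (x : U A d (r : K) (s : K)) (j β) μ
        have h2 : omMu A d (r : K) s μ * (x : U A d (r : K) (s : K)) * omMu A d (r : K) s (-μ) =
            ((eulerChar A d r s γ μ : Kˣ) : K) • (x : U A d (r : K) (s : K)) := by
          rw [(hx μ).1, eulerChar_apply]
          push_cast
          rfl
        rw [h2, hj] at h1
        simp only [GradedRing.proj_apply, DirectSum.decompose_smul, DirectSum.smul_apply,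
          Submodule.coe_smul] at h1 hne
        exact Units.ext (smul_left_injective K hne h1).symm
      · exact hout x δ hδ'
    change (x : U A d (r : K) (s : K)) ∈ bigrading A d (r : K) s (j γ)
    classical
    rw [← DirectSum.sum_support_decompose (bigrading A d (r : K) s) (x : U A d (r : K) (s : K))]
    refine sum_mem fun δ _ => ?_
    by_cases hδ : δ = j γ
    · rw [← hδ]; exact SetLike.coe_mem _
    · rw [← GradedRing.proj_apply, hzero δ hδ]; exact zero_mem _
  · intro hx μ
    have h1 := omMu_conj A d r s (γ := j γ) hx μ
    have h2 := ompMu_conj A d r s (γ := j γ) hx μ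
    rw [hj, eulerChar_apply] at h1 h2
    push_cast at h1 h2
    exact ⟨h1, h2.trans (by rw [mul_comm]; rfl)⟩

theorem weightSpace_plus (hA : IsSimpleCartan A d) (hrs : ∀ m : ℕ, 0 < m → (r / s) ^ m ≠ 1)
    (γ : RootLattice n) :
    weightSpace A d (r : K) s (plus A d (r : K) s) γ = plusGrading A d (r : K) s γ := by
  let : GradedAlgebra (subGrading (bigrading A d (r : K) s) (plus A d (r : K) s)
      (AddMonoidHom.inl (RootLattice n) (RootLattice n))) :=
    (inferInstance : GradedAlgebra (plusGrading A d (r : K) s))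
  exact weightSpace_eq_subGrading A d r s hA hrs _
    (AddMonoidHom.inl _ _) (fun β => by simp [totalDegree_apply]) γ

theorem weightSpace_minus (hA : IsSimpleCartan A d) (hrs : ∀ m : ℕ, 0 < m → (r / s) ^ m ≠ 1)
    (γ : RootLattice n) :
    weightSpace A d (r : K) s (minus A d (r : K) s) γ = minusGrading A d (r : K) s γ := by
  let : GradedAlgebra (subGrading (bigrading A d (r : K) s) (minus A d (r : K) s)
      (AddMonoidHom.inr (RootLattice n) (RootLattice n))) :=
    (inferInstance : GradedAlgebra (minusGrading A d (r : K) s))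
  exact weightSpace_eq_subGrading A d r s hA hrs _
    (AddMonoidHom.inr _ _) (fun β => by simp [totalDegree_apply]) γ

end Weight

/-! ### Twists of graded subalgebras -/

section Restrict

variable {K B G H : Type*} [Field K] [Ring B] [Algebra K B] [AddCommGroup G] [DecidableEq G]
  [AddCommGroup H] [DecidableEq H]
variable (𝒜 : G → Submodule K B) [GradedAlgebra 𝒜] (S : Subalgebra K B) (j : H →+ G)
  [GradedAlgebra (subGrading 𝒜 S j)] (Ψ : Bicharacter G K) (ψ : Bicharacter H K)

/-- The inclusion of the twist of a graded subalgebra into the twist. -/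
def subTwistHom (hψ : ∀ a b, Ψ (j a) (j b) = ψ a b) :
    GradedTwist (subGrading 𝒜 S j) ψ →ₐ[K] GradedTwist 𝒜 Ψ :=
  AlgHom.ofLinearMap ((GradedTwist.of 𝒜 Ψ).toLinearMap ∘ₗ S.val.toLinearMap ∘ₗ
      (GradedTwist.of (subGrading 𝒜 S j) ψ).symm.toLinearMap) rfl (by
    suffices h : ∀ x y : S, GradedTwist.of 𝒜 Ψ (twistMul (subGrading 𝒜 S j) ψ x y : S) =
        GradedTwist.of 𝒜 Ψ (x : B) * GradedTwist.of 𝒜 Ψ (y : B) from fun x y => h x y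
    intro x y
    induction x using DirectSum.Decomposition.inductionOn (subGrading 𝒜 S j) with
    | zero => simp
    | add a b ha hb => simp only [map_add, LinearMap.add_apply, Subalgebra.coe_add, ha, hb, add_mul]
    | @homogeneous g x =>
      induction y using DirectSum.Decomposition.inductionOn (subGrading 𝒜 S j) with
      | zero => simp
      | add a b ha hb => simp only [map_add, Subalgebra.coe_add, ha, hb, mul_add]
      | @homogeneous h y =>
        have e := GradedTwist.of_mul_of 𝒜 Ψ (g := j g) (h := j h) x.2 y.2
        rw [hψ] at e
        rw [twistMul_of_mem _ ψ x.2 y.2, Subalgebra.coe_smul, map_smul, Subalgebra.coe_mul]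
        exact e.symm)

theorem subTwistHom_of (hψ : ∀ a b, Ψ (j a) (j b) = ψ a b) (x : S) :
    subTwistHom 𝒜 S j Ψ ψ hψ (GradedTwist.of (subGrading 𝒜 S j) ψ x) =
      GradedTwist.of 𝒜 Ψ (x : B) := rfl

theorem subTwistHom_injective (hψ : ∀ a b, Ψ (j a) (j b) = ψ a b) :
    Function.Injective (subTwistHom 𝒜 S j Ψ ψ hψ) := fun _ _ h => Subtype.ext h

theorem mem_range_subTwistHom (hψ : ∀ a b, Ψ (j a) (j b) = ψ a b) (y : B) :
    GradedTwist.of 𝒜 Ψ y ∈ (subTwistHom 𝒜 S j Ψ ψ hψ).range ↔ y ∈ S :=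
  ⟨fun ⟨x, hx⟩ => by
    have := (GradedTwist.of 𝒜 Ψ).injective (hx : GradedTwist.of 𝒜 Ψ _ = _)
    rw [← this]
    exact Subtype.prop _, fun hy => ⟨GradedTwist.of _ ψ ⟨y, hy⟩, rfl⟩⟩

end Restrict

/-! ### Restriction of the isomorphism to generated subalgebras -/

section RestrictEquiv

variable {K : Type*} [Field K] {n : ℕ}
variable {A : Matrix (Fin n) (Fin n) ℤ} {d : Fin n → ℕ} {r s r' s' : K}
  {ζ : Bicharacter (RootLattice n) K}

theorem genScale_ne_zero (hs : s ≠ 0) (hs' : s' ≠ 0) (x : Gen n) : genScale d s s' x ≠ 0 :=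
  left_ne_zero_of_mul_eq_one (genScale_mul_genScale hs hs' x)

theorem adjoin_range_smul {K B X : Type*} [Field K] [Ring B] [Algebra K B] (g : X → B) (c : X → K)
    (hc : ∀ x, c x ≠ 0) : Algebra.adjoin K (Set.range fun x => c x • g x) =
      Algebra.adjoin K (Set.range g) := by
  apply le_antisymm <;> refine Algebra.adjoin_le ?_ <;> rintro _ ⟨x, rfl⟩
  · exact Subalgebra.smul_mem _ (Algebra.subset_adjoin (Set.mem_range_self x)) _
  · have : g x = (c x)⁻¹ • c x • g x := by rw [smul_smul, inv_mul_cancel₀ (hc x), one_smul]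
    rw [this]
    exact Subalgebra.smul_mem _
      (Algebra.subset_adjoin (Set.mem_range_self (f := fun x => c x • g x) x)) _

theorem TwistCompat.equiv_mem_adjoin (h : TwistCompat A d r s r' s' ζ) {X : Type*} (x : X → Gen n) :
    (Algebra.adjoin K (Set.range fun i => gen A d r s (x i))).map (h.equiv : _ →ₐ[K] _) =
      Algebra.adjoin K (Set.range fun i => tgen A d r' s' ζ (x i)) := by
  rw [AlgHom.map_adjoin, ← Set.range_comp,
    ← adjoin_range_smul (fun i => tgen A d r' s' ζ (x i)) (fun i => genScale d s s' (x i))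
      fun i => genScale_ne_zero h.s_ne h.s_ne' (x i)]
  congr 2
  funext i
  exact h.equiv_gen (x i)

/-- The image of `S` is generated by the twisted generators, and its underlying space is that of
`S'`, i.e. the range of `subTwistHom`; φ is the restriction followed by the inverse of that
inclusion. It is graded because both gradings are pulled back along the same `j`. Leaving `j`
general treats U⁺ and U⁻ together. -/
theorem TwistCompat.exists_restrict (h : TwistCompat A d r s r' s' ζ) {X : Type*} (x : X → Gen n)
    (S : Subalgebra K (U A d r s)) (S' : Subalgebra K (U A d r' s'))
    (hS : S = Algebra.adjoin K (Set.range fun i => gen A d r s (x i)))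
    (hS' : S' = Algebra.adjoin K (Set.range fun i => gen A d r' s' (x i)))
    (j : RootLattice n →+ RootLattice n × RootLattice n)
    [GradedAlgebra (subGrading (bigrading A d r' s') S' j)]
    (ψ : Bicharacter (RootLattice n) K) (hψ : ∀ a b, ζ.double (j a) (j b) = ψ a b) :
    ∃ φ : S ≃ₐ[K] GradedTwist (subGrading (bigrading A d r' s') S' j) ψ,
      (∀ y, subTwistHom (bigrading A d r' s') S' j ζ.double ψ hψ (φ y) =
        h.equiv (y : U A d r s)) ∧
      ∀ β, (subGrading (bigrading A d r s) S j β).map φ.toLinearMap =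
        GradedTwist.piece (subGrading (bigrading A d r' s') S' j) ψ β := by
  have hrange : S.map (h.equiv : _ →ₐ[K] _) =
      (subTwistHom (bigrading A d r' s') S' j ζ.double ψ hψ).range := by
    rw [hS, h.equiv_mem_adjoin]
    ext y
    obtain ⟨y, rfl⟩ := (GradedTwist.of (bigrading A d r' s') ζ.double).surjective y
    rw [mem_range_subTwistHom, hS',
      GradedTwist.of_mem_adjoin_iff _ _ (fun i => gen_mem (x i)) y]
  let φ : S ≃ₐ[K] GradedTwist (subGrading (bigrading A d r' s') S' j) ψ :=
    (h.equiv.subalgebraMap S).trans ((Subalgebra.equivOfEq _ _ hrange).trans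
      (AlgEquiv.ofInjective _ (subTwistHom_injective (bigrading A d r' s') S' j ζ.double ψ
        hψ)).symm)
  have hφ : ∀ y, subTwistHom (bigrading A d r' s') S' j ζ.double ψ hψ (φ y) =
      h.equiv (y : U A d r s) := fun y =>
    congrArg Subtype.val ((AlgEquiv.ofInjective _
      (subTwistHom_injective (bigrading A d r' s') S' j ζ.double ψ hψ)).apply_symm_apply _)
  refine ⟨φ, hφ, fun β => ?_⟩
  have mem (y : S) : φ y ∈ GradedTwist.piece (subGrading (bigrading A d r' s') S' j) ψ β ↔
      y ∈ subGrading (bigrading A d r s) S j β := by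
    obtain ⟨z, hz⟩ := (GradedTwist.of (subGrading (bigrading A d r' s') S' j) ψ).surjective (φ y)
    have h1 := hφ y
    rw [← hz, subTwistHom_of] at h1
    change _ ↔ (y : U A d r s) ∈ bigrading A d r s (j β)
    rw [← hz, GradedTwist.of_mem_piece, ← h.equiv_mem_piece, ← h1, GradedTwist.of_mem_piece]
    rfl
  ext y
  obtain ⟨x, rfl⟩ := φ.surjective y
  rw [mem]
  exact ⟨fun ⟨x', hx', e⟩ => φ.injective e ▸ hx', fun hx => ⟨x, hx, rfl⟩⟩

end RestrictEquiv

/-- For s' = q⁻¹ the structure constant is q^{⟨j,i⟩+⟨i,j⟩} = q^{dᵢaᵢⱼ}, exactly the factor divided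
out in p_{ij}. -/
theorem twistCompat {K : Type*} [Field K] {n : ℕ}
    {A : Matrix (Fin n) (Fin n) ℤ} {d : Fin n → ℕ} (hA : IsSimpleCartan A d)
    {r s q : K} (hr : r ≠ 0) (hs : s ≠ 0)
    (hrs : ∀ m : ℕ, 0 < m → (r / s) ^ m ≠ 1)
    (hq : ∀ i, r ^ d i / s ^ d i = q ^ (2 * d i)) (hq0 : q ≠ 0)
    {ζ : Bicharacter (RootLattice n) K} (hζ : ζ.IsSkew)
    (hp : ∀ i j, ((ζ (α i) (α j) : Kˣ) : K) ^ 2 = pScalar A d r s q i j) :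
    TwistCompat A d r s q q⁻¹ ζ where
  r_ne := hr
  s_ne := hs
  r_ne' := hq0
  s_ne' := inv_ne_zero hq0
  ratio i := by rw [hq, inv_pow, div_inv_eq_mul, ← pow_add, two_mul]
  ratio_ne i := by rw [← div_pow]; exact hrs _ (hA.d_pos i)
  skew := hζ
  sq i j := by
    rw [hp, pScalar, inv_zpow', neg_neg, ← zpow_add₀ hq0, add_comm (euler A d j i),
      hA.euler_add_euler, mul_assoc, ← zpow_add₀ hq0, neg_add_cancel, zpow_zero, mul_one]

end TwoParam

end

/-! ### The main theorem -/

open TwoParam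
theorem mainTheorem8 {K : Type*} [Field K] [CharZero K] {n : ℕ}
    (A : Matrix (Fin n) (Fin n) ℤ) (d : Fin n → ℕ) (hA : IsSimpleCartan A d)
    (r s q : K) (hr : r ≠ 0) (hs : s ≠ 0)
    (hrs : ∀ m : ℕ, 0 < m → (r / s) ^ m ≠ 1)
    (hq : ∀ i, r ^ d i / s ^ d i = q ^ (2 * d i))
    (ζ : Bicharacter (RootLattice n) K) (hζ : ζ.IsSkew)
    (hp : ∀ i j, ((ζ (α i) (α j) : Kˣ) : K) ^ 2 = pScalar A d r s q i j) :
    ∃ Φ : U A d r s ≃ₐ[K] UTwist A d q ζ,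
      (∀ i, Φ (gen A d r s (.e i)) = twistGen A d q ζ (.e i) ∧
        Φ (gen A d r s (.f i)) = (s ^ d i * q ^ d i)⁻¹ • twistGen A d q ζ (.f i) ∧
        Φ (gen A d r s (.om i)) = twistGen A d q ζ (.om i) ∧
        Φ (gen A d r s (.omp i)) = twistGen A d q ζ (.omp i)) ∧
      (∀ γ, (bigrading A d r s γ).map Φ.toLinearMap =
        GradedTwist.piece (bigrading A d q q⁻¹) ζ.double γ) ∧
      (∃ φ : plus A d r s ≃ₐ[K] UTwistPlus A d q ζ,
        (∀ x : plus A d r s, plusIncl A d q ζ (φ x) = Φ (x : U A d r s)) ∧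
        ∀ β : RootLattice n, (weightSpace A d r s (plus A d r s) β).map φ.toLinearMap =
          GradedTwist.piece (plusGrading A d q q⁻¹) ζ β) ∧
      (∃ φ : minus A d r s ≃ₐ[K] UTwistMinus A d q ζ,
        (∀ x : minus A d r s, minusIncl A d q ζ (φ x) = Φ (x : U A d r s)) ∧
        ∀ β : RootLattice n, (weightSpace A d r s (minus A d r s) β).map φ.toLinearMap =
          GradedTwist.piece (minusGrading A d q q⁻¹) ζ.inv β) := by
  have hq0 : q ≠ 0 := by
    -- Rank 0 is excluded because the gcd of the empty family is 0, not 1. In positive rank, q = 0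
    -- would make a quotient of nonzero powers of r and s vanish.
    rcases n with - | n
    · simpa using hA.d_gcd
    · rintro rfl
      have h0 := hq 0
      rw [zero_pow (by have := hA.d_pos 0; omega)] at h0
      exact div_ne_zero (pow_ne_zero _ hr) (pow_ne_zero _ hs) h0
  have h := TwoParam.twistCompat hA hr hs hrs hq hq0 hζ hp
  have hrs' : ∀ m : ℕ, 0 < m → (Units.mk0 r hr / Units.mk0 s hs) ^ m ≠ 1 := fun m hm e =>
    hrs m hm (by simpa using congrArg Units.val e)
  refine ⟨h.equiv, fun i => ⟨?_, ?_, ?_, ?_⟩, h.map_bigrading, ?_, ?_⟩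
  · exact (h.equiv_gen _).trans (one_smul _ _)
  · rw [h.equiv_gen, genScale, mul_inv_rev, inv_pow, div_eq_mul_inv]
    rfl
  · exact (h.equiv_gen _).trans (one_smul _ _)
  · exact (h.equiv_gen _).trans (one_smul _ _)
  · let : GradedAlgebra (subGrading (bigrading A d q q⁻¹) (plus A d q q⁻¹)
        (AddMonoidHom.inl (RootLattice n) (RootLattice n))) :=
      (inferInstance : GradedAlgebra (plusGrading A d q q⁻¹))
    obtain ⟨φ, hφ, hβ⟩ := h.exists_restrict Gen.e (plus A d r s) (plus A d q q⁻¹) rfl rfl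
      (AddMonoidHom.inl _ _) ζ (fun a b => by
        simp [Bicharacter.double_apply, Bicharacter.zero_left])
    refine ⟨φ, hφ, fun β => ?_⟩
    exact (congrArg _ (weightSpace_plus A d (Units.mk0 r hr) (Units.mk0 s hs) hA hrs' β)).trans (hβ β)
  · let : GradedAlgebra (subGrading (bigrading A d q q⁻¹) (minus A d q q⁻¹)
        (AddMonoidHom.inr (RootLattice n) (RootLattice n))) :=
      (inferInstance : GradedAlgebra (minusGrading A d q q⁻¹))
    obtain ⟨φ, hφ, hβ⟩ := h.exists_restrict Gen.f (minus A d r s) (minus A d q q⁻¹) rfl rfl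
      -- On bidegrees (0, β) only the inverted second factor of ζ~ survives, hence the twist of U⁻
      -- by ζ⁻¹.
      (AddMonoidHom.inr _ _) ζ.inv (fun a b => by
        simp [Bicharacter.double_apply, Bicharacter.zero_left, Bicharacter.inv_apply])
    refine ⟨φ, hφ, fun β => ?_⟩
    exact (congrArg _ (weightSpace_minus A d (Units.mk0 r hr) (Units.mk0 s hs) hA hrs' β)).trans (hβ β)
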